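/- Let $\Phi$ be an irreducible reduced crystallographic root system (the root system of a connected simple algebraic group over $\mathbf C$) with simple roots $\Pi$, positive roots $\Phi^+$, highest root $\theta$, Weyl group $W$ and coroot lattice $Q^\vee$. For $\alpha,\beta\in\Phi$ write $\alpha\prec\beta$ if $\beta-\alpha$ is a (nonempty) sum of positive roots. An ideal is a set $\mathcal I\subseteq\Phi^+$ such that $\alpha\in\mathcal I$, $\beta\in\Phi^+$, $\alpha+\beta\in\Phi^+$ imply $\alpha+\beta\in\mathcal I$; it is strictly positive if $\mathcal I\cap\Pi=\emptyset$. Let $W_a=W\ltimes Q^\vee$ be the affine Weyl group, with $\tau_\lambda$ the element given by $\lambda\in Q^\vee$, and let $l$ be its length function with respect to the simple reflections $s_\alpha$ $(\alpha\in\Pi)$ and $s_0=s_\theta\tau_{-\theta^\vee}$. Affine roots are the symbols $\alpha+m\delta$ with $\alpha\in\Phi$, $m\in\mathbf Z$, and $W_a$ acts on them by $w_f\tau_\lambda(\alpha+m\delta)=w_f(\alpha)+(m+\langle\alpha,\lambda\rangle)\delta$ for $w_f\in W$, $\lambda\in Q^\vee$. The affine root $\alpha+m\delta$ is positive if either $\alpha\in\Phi^+$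 and $m>0$, or $-\alpha\in\Phi^+$ and $m\ge 0$, and negative otherwise. The affine simple roots are the $-\alpha$ with $\alpha\in\Pi$ together with $\theta+\delta$; the negative affine simple roots are their negatives. For $w\in W_a$ let $N(w)$ be the set of positive affine roots $\tilde\alpha$ such that $w^{-1}(\tilde\alpha)$ is negative, and let $\mathrm{supp}(w)$ be the set of $\alpha\in\Phi$ such that $\alpha+m\delta\in N(w)$ for some $m$. For an ideal $\mathcal I$ let $ST(\mathcal I)=\{w\in W_a : \mathrm{supp}(w)=\mathcal I\}$. Let $\mathcal I$ be an ideal. (1) Let $w=w_{\min}$ be the element of minimal length in $ST(\mathcal I)$. If $\alpha$ is a minimal element of $\mathcal I$ with respect to $\prec$, then $w^{-1}(\alpha+\delta)$ is a negative affine simple root. (2) Suppose $\mathcal I$ is strictly positive and let $w=w_{\max}$ be the element of maximal length in $ST(\mathcal I)$. If $\alpha$ is a maximal element of $\Phi^+\setminus\mathcal I$ with respect to $\prec$, then $w^{-1}(\alpha+\delta)$ is an affine simple root. -/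

import Mathlib

noncomputable section

namespace ShiIdeal

/-! Throughout `P` is a root system `Φ = {P.root i | i : ι} ⊆ M` with coroots in `N = V = Q^∨ ⊗ ℝ`,
and `b` is a base of `P` (the simple roots `Π = {P.root i | i ∈ b.support}`).
Roots are referred to by their indices `i : ι`. -/

variable {ι M N : Type*} [AddCommGroup M] [Module ℝ M] [AddCommGroup N] [Module ℝ N]

/-! ### The root order, ideals, minimal and maximal roots -/

section Ideals

variable {P : RootPairing ι ℝ M N} (b : P.Base)

/-- `α ≺ β`: the difference `β - α` is a sum of (one or more) positive roots. -/
def RootLT (i j : ι) : Prop :=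
  P.root j - P.root i ∈ AddSubsemigroup.closure (P.root '' {k | b.IsPos k})

/-- Ideals (upper order ideals) of `Φ⁺`. -/
structure IsIdeal (I : Set ι) : Prop where
  pos : ∀ i ∈ I, b.IsPos i
  add_mem : ∀ i ∈ I, ∀ j, b.IsPos j → ∀ k, b.IsPos k →
    P.root k = P.root i + P.root j → k ∈ I

/-- An ideal is strictly positive if it contains no simple root. -/
def IsStrictlyPositive (I : Set ι) : Prop := I ∩ b.support = ∅

/-- `α` is a minimal root of `I`. -/
def IsMinimalRoot (I : Set ι) (i : ι) : Prop :=
  i ∈ I ∧ ∀ j, b.IsPos j → RootLT b j i → j ∉ I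

/-- `α` is a maximal element of `Φ⁺ \ I`. -/
def IsMaximalOutside (I : Set ι) (i : ι) : Prop :=
  (b.IsPos i ∧ i ∉ I) ∧ ∀ j, b.IsPos j → j ∉ I → ¬ RootLT b i j

/-- `θ` is the highest root: every other root is smaller. -/
def IsHighestRoot (i : ι) : Prop := ∀ j, j ≠ i → RootLT b j i

end Ideals

/-! ### The affine Weyl group `W ⋉ Q^∨` -/

section AffineWeyl

variable (P : RootPairing ι ℝ M N)

variable {P} in
/-- Automorphisms of the root system preserve the coroot lattice. -/
lemma coweightMap_mem_corootSpan (g : P.Aut) {x : N} (hx : x ∈ P.corootSpan ℤ) :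
    g.toHom.coweightMap x ∈ P.corootSpan ℤ := by
  induction hx using Submodule.span_induction with
  | mem x hx =>
    obtain ⟨i, rfl⟩ := hx
    rw [RootPairing.Hom.coroot_coweightMap_apply]
    exact Submodule.subset_span (Set.mem_range_self _)
  | zero => simp
  | add x y _ _ hx hy => rw [map_add]; exact add_mem hx hy
  | smul t x _ hx => rw [map_zsmul]; exact Submodule.smul_mem _ t hx

/-- The action of the Weyl group `W` on the coroot lattice `Q^∨`. Mathlib's `coweightMap` is
contravariant, so `g` acts by the `coweightMap` of `g⁻¹`; this is the restriction of the usual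
action on `V`, characterised by `⟨g α, g v⟩ = ⟨α, v⟩`. -/
def weylOnCorootLattice (g : P.weylGroup) : P.corootSpan ℤ ≃+ P.corootSpan ℤ where
  toFun := fun x => ⟨((g : P.Aut)⁻¹).toHom.coweightMap x, coweightMap_mem_corootSpan _ x.2⟩
  invFun := fun x => ⟨(g : P.Aut).toHom.coweightMap x, coweightMap_mem_corootSpan _ x.2⟩
  left_inv := fun x => Subtype.ext <|
    RootPairing.Equiv.coweightMap_coweightEquiv_symm P P (g : P.Aut) (x : N)
  right_inv := fun x => Subtype.ext <|
    RootPairing.Equiv.coweightEquiv_symm_coweightMap P P (g : P.Aut) (x : N)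
  map_add' := fun x y => Subtype.ext <| map_add _ (x : N) (y : N)

/-- The same action as a homomorphism, with `Q^∨` written multiplicatively. -/
def weylHom : P.weylGroup →* MulAut (Multiplicative (P.corootSpan ℤ)) where
  toFun g := AddEquiv.toMultiplicative (weylOnCorootLattice P g)
  map_one' := by
    ext x
    change ((1 : P.Aut)⁻¹).toHom.coweightMap ((Multiplicative.toAdd x : P.corootSpan ℤ) : N) = _
    rw [inv_one]
    rfl
  map_mul' g h := by
    ext x
    change (((g : P.Aut) * (h : P.Aut))⁻¹).toHom.coweightMap
      ((Multiplicative.toAdd x : P.corootSpan ℤ) : N) = _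
    rw [mul_inv_rev]
    rfl

/-- The affine Weyl group `W_a = W ⋉ Q^∨`, with `Q^∨` written multiplicatively. -/
abbrev AffineWeylGroup : Type _ :=
  Multiplicative (P.corootSpan ℤ) ⋊[weylHom P] P.weylGroup

variable {P}

/-- The translation `τ_λ` for `λ ∈ Q^∨`. -/
def translation (l : P.corootSpan ℤ) : AffineWeylGroup P :=
  SemidirectProduct.inl (Multiplicative.ofAdd l)

/-- The inclusion `W ⊆ W_a`. -/
def ofWeyl (g : P.weylGroup) : AffineWeylGroup P := SemidirectProduct.inr g

/-- The finite part `w_f` in `w = w_f τ_λ`. -/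
def finPart (w : AffineWeylGroup P) : P.weylGroup := w.right

/-- The translation part `λ` in `w = w_f τ_λ`. -/
def transPart (w : AffineWeylGroup P) : P.corootSpan ℤ :=
  weylOnCorootLattice P w.right⁻¹ (Multiplicative.toAdd w.left)

/-- Every `w` is `w_f τ_λ` with the parts just defined. -/
lemma eq_ofWeyl_mul_translation (w : AffineWeylGroup P) :
    w = ofWeyl (finPart w) * translation (transPart w) := by
  apply SemidirectProduct.ext
  · simp only [ofWeyl, finPart, translation, transPart, SemidirectProduct.mul_left,
      SemidirectProduct.left_inr, SemidirectProduct.right_inr, SemidirectProduct.left_inl, one_mul]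
    change w.left = weylHom P w.right (weylHom P w.right⁻¹ w.left)
    rw [← MulAut.mul_apply, ← map_mul, mul_inv_cancel, map_one, MulAut.one_apply]
  · simp [ofWeyl, finPart, translation]

/-- The affine root `α + m δ` is the pair `(α, m)`. -/
abbrev AffineRoot (_P : RootPairing ι ℝ M N) : Type _ := ι × ℤ

/-- `-(α + m δ)`; the index of the root `-α` is `P.reflectionPerm i i`. -/
def AffineRoot.opp (a : AffineRoot P) : AffineRoot P := (P.reflectionPerm a.1 a.1, -a.2)

/-- The action of `W_a` on affine roots: if `w = w_f τ_λ` then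
`w (α + m δ) = w_f α + (m + ⟨α, λ⟩) δ`. -/
def act [P.IsCrystallographic] (w : AffineWeylGroup P) (a : AffineRoot P) : AffineRoot P :=
  (P.weylGroupToPerm (finPart w) a.1, a.2 + P.root'In ℤ a.1 (transPart w))

variable (b : P.Base)

/-- The positive affine roots: `α + m δ` with `α ∈ Φ⁺` and `m > 0`, or `-α ∈ Φ⁺` and `m ≥ 0`. -/
def IsPosAffine (a : AffineRoot P) : Prop :=
  (b.IsPos a.1 ∧ 0 < a.2) ∨ (b.IsPos (P.reflectionPerm a.1 a.1) ∧ 0 ≤ a.2)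

/-- The simple affine roots: `-α` with `α ∈ Π`, together with `θ + δ`, `θ` the highest root. -/
def IsSimpleAffine (a : AffineRoot P) : Prop :=
  (P.reflectionPerm a.1 a.1 ∈ b.support ∧ a.2 = 0) ∨ (IsHighestRoot b a.1 ∧ a.2 = 1)

/-- The simple reflections of `W_a`: the reflections in the simple roots and
`s₀ = s_θ τ_{-θ^∨}`. -/
def simpleReflections : Set (AffineWeylGroup P) :=
  {s | ∃ i ∈ b.support, s = ofWeyl (RootPairing.weylGroup.ofIdx P i)} ∪
  {s | ∃ i, IsHighestRoot b i ∧
    s = ofWeyl (RootPairing.weylGroup.ofIdx P i) * translation (-P.corootSpanMem ℤ i)}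

/-- The Coxeter length of `w`: the least length of a word in the simple reflections with
product `w`. -/
def length (w : AffineWeylGroup P) : ℕ :=
  sInf {n | ∃ l : List (AffineWeylGroup P),
    (∀ s ∈ l, s ∈ simpleReflections b) ∧ l.prod = w ∧ l.length = n}

variable [P.IsCrystallographic]

/-- `N(w)`: the positive affine roots that `w⁻¹` makes negative. -/
def inversions (w : AffineWeylGroup P) : Set (AffineRoot P) :=
  {a | IsPosAffine b a ∧ ¬ IsPosAffine b (act w⁻¹ a)}

/-- `supp(w)`: the roots `α` such that `α + m δ ∈ N(w)` for some `m`. -/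
def supp (w : AffineWeylGroup P) : Set ι :=
  {i | ∃ m : ℤ, ((i, m) : AffineRoot P) ∈ inversions b w}

/-- `ST(I)`: the elements of `W_a` with support `I`. -/
def ST (I : Set ι) : Set (AffineWeylGroup P) := {w | supp b w = I}

/-- `w` is an element of minimal length in `ST(I)`. -/
def IsMinElement (I : Set ι) (w : AffineWeylGroup P) : Prop :=
  w ∈ ST b I ∧ ∀ u ∈ ST b I, length b w ≤ length b u

/-- `w` is an element of maximal length in `ST(I)`. -/
def IsMaxElement (I : Set ι) (w : AffineWeylGroup P) : Prop :=
  w ∈ ST b I ∧ ∀ u ∈ ST b I, length b u ≤ length b w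

end AffineWeyl

end ShiIdeal

end

/-! View affine roots as vectors in `M × ℝ`, with imaginary root `delta`. Let P be the positive
affine roots and Q the affine roots that w⁻¹ makes negative (minimal case) or positive (maximal
case). Q is again a positive system; its simple elements are the roots that w⁻¹ sends to negative
simple, respectively simple, affine roots. The claim is thus that α+δ, which lies in P ∩ Q, is
simple in Q.

Extremality of the length controls the simple elements of Q lying in P. Passing from w to w s_β
changes N(w) in one root only, so for minimal w such an element is γ+δ with γ ∈ I
(`IsMinElement.eq_one_of_descent`), and for maximal w its finite part is outside I
(`IsMaxElement.notMem_of_ascent`). Hence they all lie in an explicit set G ⊆ Q (`minGenerators`,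
`maxGenerators`). This G is coclosed: if a sum of two elements of P is in G, so is one of the two.
Coclosedness passes to the closure T of G under sums that are roots (`SumClosure.coclosed`), and
then T contains P ∩ Q (`SumClosure.of_mem_inter`).

Suppose α+δ = x+y with x, y ∈ Q. If both are in P, both are in T, which the minimality or maximality
of α forbids. If only x is in P, then x = (α+δ)+(-y) is in T, and `SumClosure.of_add_indecomposable`
gives -y ∈ T ⊆ Q, absurd because y ∈ Q. Differences of real roots may be multiples of δ, so shifts
by δ are treated as a separate case throughout. `mem_simple_of_indecomposable` is this argument in
abstract form. -/

namespace ShiIdeal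

/-! ### Abstract positive systems and closures under addition. -/

section PositiveSystems

variable {E : Type*} [AddCommGroup E]

/-- The elements of `R` obtained from `G` by successive additions that stay inside `R`. -/
inductive SumClosure (R G : Set E) : E → Prop
  | base {g : E} : g ∈ G → SumClosure R G g
  | add {x y : E} : SumClosure R G x → SumClosure R G y → x + y ∈ R → SumClosure R G (x + y)

/-- A positive system in a symmetric set `R`. -/
structure IsPositiveSystem (R P : Set E) : Prop where
  subset : P ⊆ R
  neg_mem : ∀ x ∈ R, -x ∈ R
  total : ∀ x ∈ R, x ∈ P ∨ -x ∈ P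
  neg_notMem : ∀ x ∈ P, -x ∉ P
  add_mem : ∀ x ∈ P, ∀ y ∈ P, x + y ∈ R → x + y ∈ P

/-- Two decompositions of an element of `R` as a sum of two elements of `R` can be compared, up to
multiples of `d`. -/
def HasExchange (R : Set E) (d : E) : Prop :=
  ∀ a ∈ R, ∀ b ∈ R, ∀ x ∈ R, ∀ y ∈ R, a + b = x + y → a + b ∈ R →
    (x - a ∈ R ∨ ∃ j : ℤ, x - a = j • d) ∨ (x - b ∈ R ∨ ∃ j : ℤ, x - b = j • d)

variable {R P Q G : Set E} {d : E}

lemma SumClosure.mem_ambient (hG : G ⊆ R) {x : E} (hx : SumClosure R G x) : x ∈ R := by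
  cases hx with
  | base h => exact hG h
  | add _ _ h => exact h

lemma SumClosure.mem_of_subset (hQ : IsPositiveSystem R Q) (hG : G ⊆ Q) {x : E}
    (hx : SumClosure R G x) : x ∈ Q := by
  induction hx with
  | base h => exact hG h
  | add _ _ h h₁ h₂ => exact hQ.add_mem _ h₁ _ h₂ h

lemma SumClosure.add_shift (hR : ∀ x ∈ R, ∀ j : ℤ, x + j • d ∈ R)
    (hGd : ∀ g ∈ G, g + d ∈ G) {x : E} (hx : SumClosure R G x) :
    SumClosure R G (x + d) := by
  induction hx with
  | base h => exact .base (hGd _ h)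
  | @add x y _ hy h h₁ _ =>
    have : x + y + d = (x + d) + y := by abel
    rw [this]
    refine .add h₁ hy ?_
    rw [← this]
    simpa using hR _ h 1

lemma SumClosure.add_nsmul (hR : ∀ x ∈ R, ∀ j : ℤ, x + j • d ∈ R)
    (hGd : ∀ g ∈ G, g + d ∈ G) {x : E} (hx : SumClosure R G x) (j : ℕ) :
    SumClosure R G (x + j • d) := by
  induction j with
  | zero => simpa
  | succ j ih => rw [succ_nsmul, ← add_assoc]; exact ih.add_shift hR hGd

/-- Induction on the way t is built. If t = x + y = a + b, exchange compares x with a or with b. In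
the first case put μ = x - a, so that b = μ + y and a = x - μ. According to the sign of μ, the
induction hypothesis applies to x = a + μ or to y = b + (-μ); if μ is a multiple of d, then a or b
is a shift of x or y. -/
lemma SumClosure.coclosed (hP : IsPositiveSystem R P) (hex : HasExchange R d) (hG : G ⊆ R)
    (hR : ∀ x ∈ R, ∀ j : ℤ, x + j • d ∈ R) (hGd : ∀ g ∈ G, g + d ∈ G)
    (hbase : ∀ a ∈ P, ∀ b ∈ P, a + b ∈ G → a ∈ G ∨ b ∈ G) {t : E} (ht : SumClosure R G t) :
    ∀ a ∈ P, ∀ b ∈ P, t = a + b → SumClosure R G a ∨ SumClosure R G b := by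
  induction ht with
  | base h =>
    rintro a ha b hb rfl
    exact (hbase a ha b hb h).imp .base .base
  | @add x y hx hy h ihx ihy =>
    have key : ∀ a ∈ P, ∀ b ∈ P, x + y = a + b → (x - a ∈ R ∨ ∃ j : ℤ, x - a = j • d) →
        SumClosure R G a ∨ SumClosure R G b := by
      intro a ha b hb hab hxa
      have hbe : b = (x - a) + y := by rw [sub_add_eq_add_sub, hab]; abel
      rcases hxa with hxa | ⟨j, hj⟩
      · rcases hP.total _ hxa with hμ | hμ
        · rcases ihx a ha _ hμ (by abel) with h' | h'
          · exact .inl h'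
          · right
            rw [hbe]
            exact .add h' hy (hbe ▸ hP.subset hb)
        · rcases ihy b hb _ hμ (by rw [hbe]; abel) with h' | h'
          · exact .inr h'
          · left
            have hae : a = x + -(x - a) := by abel
            rw [hae]
            exact .add hx h' (hae ▸ hP.subset ha)
      · rcases Int.eq_nat_or_neg j with ⟨n, rfl | rfl⟩
        · right
          rw [hbe, hj, add_comm, natCast_zsmul]
          exact hy.add_nsmul hR hGd n
        · left
          have hae : a = x + n • d := by
            rw [neg_smul, natCast_zsmul] at hj
            rw [eq_comm, ← sub_eq_zero, ← sub_eq_zero.mpr hj]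
            abel
          rw [hae]
          exact hx.add_nsmul hR hGd n
    intro a ha b hb hab
    rcases hex a (hP.subset ha) b (hP.subset hb) x (hx.mem_ambient hG) y
      (hy.mem_ambient hG) hab.symm (hab ▸ h) with h' | h'
    · exact key a ha b hb hab h'
    · exact (key b hb a ha (by rw [hab, add_comm]) h').symm

/-- A variant of `SumClosure.coclosed` with an indecomposable summand `α`. -/
lemma SumClosure.of_add_indecomposable (hP : IsPositiveSystem R P) (hex : HasExchange R d)
    (hG : G ⊆ R) (hR : ∀ x ∈ R, ∀ j : ℤ, x + j • d ∈ R) (hGd : ∀ g ∈ G, g + d ∈ G)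
    (hbase : ∀ a ∈ P, ∀ b ∈ P, a + b ∈ G → a ∈ G ∨ b ∈ G) {α : E} (hα : α ∈ P)
    (hαG : ∀ b ∈ P, α + b ∈ G → b ∈ G)
    (hind : ∀ x y, SumClosure R G x → SumClosure R G y → y ∈ P → α ≠ x + y)
    (hαd : ∀ j : ℕ, 0 < j → ¬ SumClosure R G (α - j • d)) {t : E} (ht : SumClosure R G t) :
    ∀ b ∈ P, t = α + b → SumClosure R G b := by
  induction ht with
  | base h =>
    rintro b hb rfl
    exact .base (hαG b hb h)
  | @add x y hx hy h ihx ihy =>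
    have key : ∀ x y, SumClosure R G x → SumClosure R G y →
        (∀ b ∈ P, x = α + b → SumClosure R G b) → ∀ b ∈ P, x + y = α + b →
        (x - α ∈ R ∨ ∃ j : ℤ, x - α = j • d) → SumClosure R G b := by
      intro x y hx hy ihx b hb hab hxa
      have hbe : b = (x - α) + y := by rw [sub_add_eq_add_sub, hab]; abel
      rcases hxa with hxa | ⟨j, hj⟩
      -- With μ = x - α: if μ ∈ P, induct on x = α + μ. If -μ ∈ P, coclosedness of y = b + (-μ)
      -- yields b, since -μ in the closure would decompose α as x + (-μ).
      · rcases hP.total _ hxa with hμ | hμ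
        · rw [hbe]
          exact .add (ihx _ hμ (by abel)) hy (hbe ▸ hP.subset hb)
        · refine (hy.coclosed hP hex hG hR hGd hbase b hb _ hμ (by rw [hbe]; abel)).resolve_right
            fun h' ↦ hind _ _ hx h' hμ (by abel)
      · rcases Int.eq_nat_or_neg j with ⟨n, rfl | rfl⟩
        · rw [hbe, hj, add_comm, natCast_zsmul]
          exact hy.add_nsmul hR hGd n
        · have hxe : x = α - n • d := by
            rw [neg_smul, natCast_zsmul] at hj
            rw [← sub_eq_zero, ← sub_eq_zero.mpr hj]
            abel
          rcases n.eq_zero_or_pos with rfl | hn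
          · have : b = y := by rw [hbe, hj]; simp
            rwa [this]
          · exact absurd (hxe ▸ hx) (hαd n hn)
    intro b hb hab
    rcases hex α (hP.subset hα) b (hP.subset hb) x (hx.mem_ambient hG) y
      (hy.mem_ambient hG) hab.symm (hab ▸ h) with h' | h'
    · exact key x y hx hy ihx b hb hab h'
    · refine key y x hy hx ihy b hb (by rw [add_comm, hab]) ?_
      -- The second exchange alternative compares x with b, hence also y with α, so the same
      -- argument runs with x and y swapped.
      have hyα : y - α = -(x - b) := by
        rw [neg_sub, sub_eq_sub_iff_add_eq_add, add_comm, hab, add_comm]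
      rw [hyα]
      rcases h' with h' | ⟨j, hj⟩
      · exact .inl (hP.neg_mem _ h')
      · exact .inr ⟨-j, by rw [hj, neg_smul]⟩

/-- Induction along the decompositions of the elements of a positive system into simple ones. -/
def HasSimpleInduction (Q S : Set E) (d : E) : Prop :=
  ∀ p : E → Prop, (∀ x ∈ S, p x) → (∀ x ∈ Q, ∀ y ∈ Q, x + y ∈ Q → p x → p y → p (x + y)) →
    (∀ x ∈ Q, ∀ j : ℕ, 0 < j → x + j • d ∈ Q → p x → p (x + j • d)) → ∀ x ∈ Q, p x

/-- If all simple elements of `Q` that lie in `P` belong to `G`, then the closure of `G` contains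
`P ∩ Q`. -/
lemma SumClosure.of_mem_inter (hP : IsPositiveSystem R P) (hQ : IsPositiveSystem R Q)
    {S : Set E} (hQS : HasSimpleInduction Q S d) (hex : HasExchange R d) (hG : G ⊆ Q)
    (hR : ∀ x ∈ R, ∀ j : ℤ, x + j • d ∈ R) (hGd : ∀ g ∈ G, g + d ∈ G)
    (hbase : ∀ a ∈ P, ∀ b ∈ P, a + b ∈ G → a ∈ G ∨ b ∈ G)
    (hd : ∀ a ∈ P, ∀ j : ℕ, 0 < j → -(a - j • d) ∈ P → a ∈ G ∨ -(a - j • d) ∈ G)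
    (hS : ∀ x ∈ S, x ∈ P → x ∈ G) : ∀ x ∈ Q, x ∈ P → SumClosure R G x := by
  have hGR := hG.trans hQ.subset
  refine hQS _ (fun x hx hxP ↦ .base (hS x hx hxP)) ?_ ?_
  -- If x ∈ P and -y ∈ P, then x = (x + y) + (-y) splits inside P, so x + y or -y is in the closure.
  -- The latter would put -y in Q together with y.
  · have key : ∀ x ∈ Q, ∀ y ∈ Q, (x ∈ P → SumClosure R G x) → x ∈ P → -y ∈ P → x + y ∈ P →
        SumClosure R G (x + y) := by
      intro x hx y hy ihx hxP hyP hxyP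
      refine ((ihx hxP).coclosed hP hex hGR hR hGd hbase _ hxyP _ hyP (by abel)).resolve_right ?_
      intro h
      exact hQ.neg_notMem y hy (h.mem_of_subset hQ hG)
    intro x hx y hy hxy ihx ihy hxyP
    rcases hP.total x (hQ.subset hx) with hxP | hxP <;>
      rcases hP.total y (hQ.subset hy) with hyP | hyP
    · exact .add (ihx hxP) (ihy hyP) (hQ.subset hxy)
    · exact key x hx y hy ihx hxP hyP hxyP
    · rw [add_comm]
      exact key y hy x hx ihy hyP hxP (by rwa [add_comm])
    · refine absurd hxyP fun h ↦ hP.neg_notMem _ h ?_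
      rw [neg_add]
      refine hP.add_mem _ hxP _ hyP ?_
      rw [← neg_add]
      exact hP.neg_mem _ (hQ.subset hxy)
  · intro x hx j hj hxj ihx hxjP
    rcases hP.total x (hQ.subset hx) with hxP | hxP
    · exact (ihx hxP).add_nsmul hR hGd j
    · rcases hd _ hxjP j hj (by simpa using hxP) with h | h
      · exact .base h
      · rw [add_sub_cancel_right] at h
        exact absurd (hG h) (hQ.neg_notMem x hx)

/-- The criterion for `α ∈ P ∩ Q` to be simple in `Q`. -/
theorem mem_simple_of_indecomposable (hP : IsPositiveSystem R P) (hQ : IsPositiveSystem R Q)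
    {S : Set E} (hQS : HasSimpleInduction Q S d) (hex : HasExchange R d) (hG : G ⊆ Q)
    (hR : ∀ x ∈ R, ∀ j : ℤ, x + j • d ∈ R) (hGd : ∀ g ∈ G, g + d ∈ G)
    (hbase : ∀ a ∈ P, ∀ b ∈ P, a + b ∈ G → a ∈ G ∨ b ∈ G)
    (hd : ∀ a ∈ P, ∀ j : ℕ, 0 < j → -(a - j • d) ∈ P → a ∈ G ∨ -(a - j • d) ∈ G)
    (hS : ∀ x ∈ S, x ∈ P → x ∈ G) {α : E} (hαP : α ∈ P) (hαQ : α ∈ Q)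
    (hαG : ∀ b ∈ P, α + b ∈ G → b ∈ G)
    (hind : ∀ x y, SumClosure R G x → SumClosure R G y → y ∈ P → α ≠ x + y)
    (hαd : ∀ j : ℕ, 0 < j → ¬ SumClosure R G (α - j • d))
    (hαd' : ∀ j : ℕ, 0 < j → -(α - j • d) ∈ P → -(α - j • d) ∈ G) : α ∈ S := by
  have hGR := hG.trans hQ.subset
  have hT := SumClosure.of_mem_inter hP hQ hQS hex hG hR hGd hbase hd hS
  have key : ∀ x ∈ Q, ∀ y ∈ Q, x ∈ P → -y ∈ P → α ≠ x + y := by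
    intro x hx y hy hxP hyP h
    refine hQ.neg_notMem y hy (SumClosure.mem_of_subset hQ hG ?_)
    exact (hT x hx hxP).of_add_indecomposable hP hex hGR hR hGd hbase hαP hαG hind hαd _ hyP
      (by rw [h]; abel)
  -- Simple induction applied to the predicate "simple, a sum of two elements of Q, or a shift of an
  -- element of Q"; the last two alternatives are then excluded.
  have : α ∈ S ∨ (∃ x ∈ Q, ∃ y ∈ Q, α = x + y) ∨ ∃ x ∈ Q, ∃ j : ℕ, 0 < j ∧ α = x + j • d := by
    revert α
    intro α _ hαQ _ _ _ _ _
    exact hQS (fun α ↦ α ∈ S ∨ (∃ x ∈ Q, ∃ y ∈ Q, α = x + y) ∨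
        ∃ x ∈ Q, ∃ j : ℕ, 0 < j ∧ α = x + j • d) (fun x hx ↦ .inl hx)
      (fun x hx y hy _ _ _ ↦ .inr (.inl ⟨x, hx, y, hy, rfl⟩))
      (fun x hx j hj _ _ ↦ .inr (.inr ⟨x, hx, j, hj, rfl⟩)) α hαQ
  rcases this with h | ⟨x, hx, y, hy, h⟩ | ⟨x, hx, j, hj, h⟩
  · exact h
  · exfalso
    rcases hP.total x (hQ.subset hx) with hxP | hxP <;>
      rcases hP.total y (hQ.subset hy) with hyP | hyP
    · exact hind x y (hT x hx hxP) (hT y hy hyP) hyP h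
    · exact key x hx y hy hxP hyP h
    · exact key y hy x hx hyP hxP (by rw [h, add_comm])
    · refine hP.neg_notMem _ hαP ?_
      rw [h, neg_add]
      refine hP.add_mem _ hxP _ hyP ?_
      rw [← neg_add, ← h]
      exact hP.neg_mem _ (hQ.subset hαQ)
  · exfalso
    have hxα : x = α - j • d := by rw [h, add_sub_cancel_right]
    rcases hP.total x (hQ.subset hx) with hxP | hxP
    · exact hαd j hj (hxα ▸ hT x hx hxP)
    · exact hQ.neg_notMem x hx (hG (hxα ▸ hαd' j hj (hxα ▸ hxP)))

end PositiveSystems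

end ShiIdeal

noncomputable section
namespace ShiIdeal

/-! ### Finite root systems: heights and the highest root. -/

section FiniteRootSystem

variable {ι M N : Type*} [AddCommGroup M] [Module ℝ M] [AddCommGroup N] [Module ℝ N]
  {P : RootPairing ι ℝ M N}

lemma root_neg (i : ι) : P.root (P.reflectionPerm i i) = -P.root i := by simp

lemma isPos_neg_iff (b : P.Base) (i : ι) : b.IsPos (P.reflectionPerm i i) ↔ ¬ b.IsPos i :=
  RootPairing.Base.IsPos.neg_iff_not b i

lemma height_neg (b : P.Base) (i : ι) : b.height (P.reflectionPerm i i) = -b.height i :=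
  b.height_reflectionPerm_self i

/-- The height as a linear functional. -/
lemma exists_linear_height [P.IsRootSystem] (b : P.Base) :
    ∃ f : M →ₗ[ℝ] ℝ, ∀ i, f (P.root i) = b.height i := by
  refine ⟨b.toWeightBasis.constr ℝ (fun _ ↦ (1 : ℝ)), fun i ↦ ?_⟩
  have hs : ∀ j ∈ b.support, b.toWeightBasis.constr ℝ (fun _ ↦ (1 : ℝ)) (P.root j) = 1 := by
    intro j hj
    have := b.toWeightBasis.constr_basis ℝ (fun _ ↦ (1 : ℝ)) ⟨j, hj⟩
    rwa [b.toWeightBasis_apply] at this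
  obtain ⟨f, -, -, hf⟩ := b.exists_root_eq_sum_int i
  rw [RootPairing.Base.height_eq_sum hf, hf, map_sum, Int.cast_sum]
  refine Finset.sum_congr rfl fun j hj ↦ ?_
  rw [map_zsmul, hs j hj]
  simp

lemma RootLT.height_lt [P.IsRootSystem] {b : P.Base} {i j : ι} (h : RootLT b i j) :
    b.height i < b.height j := by
  obtain ⟨f, hf⟩ := exists_linear_height b
  have : ∀ x ∈ AddSubsemigroup.closure (P.root '' {k | b.IsPos k}), 0 < f x := by
    intro x hx
    induction hx using AddSubsemigroup.closure_induction with
    | mem x hx =>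
      obtain ⟨k, hk, rfl⟩ := hx
      rw [hf]
      exact_mod_cast hk
    | add x y _ _ hx hy => rw [map_add]; exact add_pos hx hy
  have h := this _ h
  rw [map_sub, hf, hf] at h
  exact_mod_cast sub_pos.mp h

lemma RootLT.of_add {b : P.Base} {i j k : ι} (hj : b.IsPos j)
    (h : P.root k = P.root i + P.root j) : RootLT b i k := by
  have : P.root k - P.root i = P.root j := by rw [h, add_sub_cancel_left]
  rw [RootLT, this]
  exact AddSubsemigroup.subset_closure ⟨j, hj, rfl⟩

lemma RootLT.trans {b : P.Base} {i j k : ι} (h : RootLT b i j) (h' : RootLT b j k) :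
    RootLT b i k := by
  have : P.root k - P.root i = (P.root j - P.root i) + (P.root k - P.root j) := by abel
  rw [RootLT, this]
  exact add_mem h h'

lemma rootLT_neg {b : P.Base} {i : ι} (h : b.IsPos i) : RootLT b (P.reflectionPerm i i) i := by
  rw [RootLT, root_neg, sub_neg_eq_add]
  have : P.root i ∈ AddSubsemigroup.closure (P.root '' {k | b.IsPos k}) :=
    AddSubsemigroup.subset_closure ⟨i, h, rfl⟩
  exact add_mem this this

variable [Finite ι] [P.IsCrystallographic]

-- Only the signs of the form matter later: they turn positivity arguments into statements about
-- Cartan integers, whose sign decides when a difference of roots is a root.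
variable (P) in
lemma exists_invariant_form : ∃ B : LinearMap.BilinForm ℝ M, (∀ x y, B x y = B y x) ∧
    (∀ i, 0 < B (P.root i) (P.root i)) ∧
    ∀ i j, 0 < B (P.root i) (P.root j) ↔ 0 < P.pairingIn ℤ i j := by
  have : Fintype ι := Fintype.ofFinite ι
  have hpos : ∀ i, 0 < P.RootForm (P.root i) (P.root i) := by
    intro i
    have h₁ := (P.posRootForm ℤ).algebraMap_rootLength i
    have h₂ := (P.posRootForm ℤ).rootLength_pos i
    change _ = P.RootForm (P.root i) (P.root i) at h₁
    rw [← h₁]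
    exact Int.cast_pos.mpr h₂
  have h2 := fun i j ↦ (P.posRootForm ℤ).two_mul_apply_root_root i j
  refine ⟨P.RootForm, P.rootForm_symmetric.eq, hpos, fun i j ↦ ?_⟩
  have h3 : 2 * P.RootForm (P.root i) (P.root j) =
      (P.pairingIn ℤ i j : ℝ) * P.RootForm (P.root j) (P.root j) := by
    have := h2 i j
    rwa [← P.algebraMap_pairingIn ℤ] at this
  constructor
  · intro h
    by_contra! hc
    have : (P.pairingIn ℤ i j : ℝ) ≤ 0 := by exact_mod_cast hc
    nlinarith [hpos j]
  · intro h
    have : (0 : ℝ) < P.pairingIn ℤ i j := by exact_mod_cast h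
    nlinarith [hpos j, mul_pos this (hpos j)]

lemma exists_root_sub_of_pairingIn_pos {i j : ι} (h : 0 < P.pairingIn ℤ i j) :
    P.root i - P.root j = 0 ∨ ∃ k, P.root k = P.root i - P.root j := by
  rcases eq_or_ne i j with rfl | hij
  · simp
  · exact .inr (P.root_sub_root_mem_of_pairingIn_pos h hij)

/-- Two decompositions of a root as a sum of two roots can be compared. -/
lemma exists_root_sub_of_add_eq_add {i j k l n : ι}
    (h : P.root i + P.root j = P.root k + P.root l) (hn : P.root n = P.root i + P.root j) :
    (P.root k - P.root i = 0 ∨ ∃ m, P.root m = P.root k - P.root i) ∨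
      (P.root k - P.root j = 0 ∨ ∃ m, P.root m = P.root k - P.root j) := by
  obtain ⟨B, hsymm, hpos, hB⟩ := exists_invariant_form P
  -- The squared length of the root n expands into four products, so one of them is positive and the
  -- corresponding difference is a root or zero. Up to sign only two differences occur.
  have hn' : 0 < B (P.root k + P.root l) (P.root i + P.root j) := by
    rw [← h, ← hn]
    exact hpos n
  simp only [map_add, LinearMap.add_apply] at hn'
  have hneg : ∀ x : M, (x = 0 ∨ ∃ m, P.root m = x) → (-x = 0 ∨ ∃ m, P.root m = -x) := by
    rintro x (rfl | ⟨m, rfl⟩)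
    · simp
    · exact .inr ⟨_, root_neg m⟩
  have e₁ : P.root k - P.root i = -(P.root l - P.root j) := by
    rw [neg_sub, sub_eq_sub_iff_add_eq_add, ← h, add_comm]
  have e₂ : P.root k - P.root j = -(P.root l - P.root i) := by
    rw [neg_sub, sub_eq_sub_iff_add_eq_add, ← h]
  by_cases h₁ : 0 < B (P.root k) (P.root i)
  · exact .inl (exists_root_sub_of_pairingIn_pos ((hB _ _).mp h₁))
  by_cases h₂ : 0 < B (P.root k) (P.root j)
  · exact .inr (exists_root_sub_of_pairingIn_pos ((hB _ _).mp h₂))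
  by_cases h₃ : 0 < B (P.root l) (P.root i)
  · rw [e₂]
    exact .inr (hneg _ (exists_root_sub_of_pairingIn_pos ((hB _ _).mp h₃)))
  by_cases h₄ : 0 < B (P.root l) (P.root j)
  · rw [e₁]
    exact .inl (hneg _ (exists_root_sub_of_pairingIn_pos ((hB _ _).mp h₄)))
  linarith

/-- A positive root to which no positive root can be added. -/
def IsMaximalRoot (b : P.Base) (i : ι) : Prop :=
  b.IsPos i ∧ ∀ j, b.IsPos j → ∀ k, P.root k ≠ P.root i + P.root j

omit [Finite ι] [P.IsCrystallographic] in
lemma IsHighestRoot.isPos [P.IsRootSystem] {b : P.Base} {i : ι} (h : IsHighestRoot b i) :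
    b.IsPos i := by
  by_contra hc
  have hn := (isPos_neg_iff b i).mpr hc
  have hne : P.reflectionPerm i i ≠ i := fun h' ↦ hc (by rwa [h'] at hn)
  have := (h _ hne).height_lt
  rw [height_neg] at this
  rw [RootPairing.Base.isPos_iff, height_neg] at hn
  lia

omit [Finite ι] [P.IsCrystallographic] in
lemma IsHighestRoot.isMaximalRoot [P.IsRootSystem] {b : P.Base} {i : ι} (h : IsHighestRoot b i) :
    IsMaximalRoot b i := by
  refine ⟨h.isPos, fun j hj k hk ↦ ?_⟩
  have h₁ := b.height_add hk
  rw [RootPairing.Base.isPos_iff] at hj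
  have hki : k ≠ i := by rintro rfl; lia
  have := (h k hki).height_lt
  lia

lemma IsMaximalRoot.pairingIn_nonneg {b : P.Base} {i j : ι} (h : IsMaximalRoot b i)
    (hj : b.IsPos j) : 0 ≤ P.pairingIn ℤ i j := by
  by_contra! hc
  obtain ⟨k, hk⟩ := P.root_add_root_mem_of_pairingIn_neg hc (by
    rw [← root_neg]
    intro he
    have := P.root.injective he
    have h' := (isPos_neg_iff b j)
    rw [← this] at h'
    exact h'.mp h.1 hj)
  exact h.2 j hj k hk

omit [Finite ι] [P.IsCrystallographic] in
lemma exists_nonneg_coeff {b : P.Base} {i : ι} (hi : b.IsPos i) :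
    ∃ f : ι → ℤ, (∀ j, 0 ≤ f j) ∧ P.root i = ∑ j ∈ b.support, f j • P.root j := by
  obtain ⟨f, -, hf₁, hf₂⟩ := b.exists_root_eq_sum_int i
  rcases hf₁ with h | h
  · exact ⟨f, h.le, hf₂⟩
  · exfalso
    rw [RootPairing.Base.isPos_iff, RootPairing.Base.height_eq_sum hf₂] at hi
    exact absurd (Finset.sum_nonpos fun j _ ↦ h.le j) (not_le.mpr hi)

/-- Two distinct maximal roots have nonpositive product, else their difference is a root and one of
them could be enlarged. Both are dominant, so every term vanishes when one is expanded in simple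
roots. By irreducibility that expansion involves all simple roots, so the other maximal root is
orthogonal to everything, itself included. -/
lemma IsMaximalRoot.eq [P.IsRootSystem] [P.IsReduced] [P.IsIrreducible] {b : P.Base} {i i' : ι}
    (h : IsMaximalRoot b i) (h' : IsMaximalRoot b i') : i = i' := by
  classical
  by_contra hne
  obtain ⟨B, hsymm, hpos, hB⟩ := exists_invariant_form P
  have hBn : ∀ i, IsMaximalRoot b i → ∀ j ∈ b.support, 0 ≤ B (P.root j) (P.root i) := by
    intro i hi j hj
    by_contra! hc
    have h1 := hi.pairingIn_nonneg (b.isPos_of_mem_support hj)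
    have h2 : 0 < B (P.root (P.reflectionPerm j j)) (P.root i) := by
      rw [root_neg, map_neg, LinearMap.neg_apply]; linarith
    rw [hsymm, hB, RootPairing.pairingIn_reflectionPerm_self_right] at h2
    lia
  have hle : B (P.root i) (P.root i') ≤ 0 := by
    by_contra! hc
    obtain ⟨k, hk⟩ := P.root_sub_root_mem_of_pairingIn_pos ((hB _ _).mp hc) hne
    by_cases hkp : b.IsPos k
    · exact h'.2 k hkp i (by rw [hk]; abel)
    · exact h.2 _ ((isPos_neg_iff b k).mpr hkp) i' (by rw [root_neg, hk]; abel)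
  obtain ⟨f, hf₀, hf⟩ := exists_nonneg_coeff h.1
  have hexp : ∀ x : M, B (P.root i) x = ∑ j ∈ b.support, (f j : ℝ) * B (P.root j) x := by
    intro x
    rw [hf]
    simp only [map_sum, map_zsmul, LinearMap.sum_apply, LinearMap.smul_apply, zsmul_eq_mul]
  have hf₀' : ∀ j, (0 : ℝ) ≤ f j := fun j ↦ by exact_mod_cast hf₀ j
  have hzero : ∀ j ∈ b.support, (f j : ℝ) * B (P.root j) (P.root i') = 0 := by
    rw [hexp] at hle
    have hnn : ∀ j ∈ b.support, 0 ≤ (f j : ℝ) * B (P.root j) (P.root i') :=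
      fun j hj ↦ mul_nonneg (hf₀' j) (hBn i' h' j hj)
    exact (Finset.sum_eq_zero_iff_of_nonneg hnn).mp (le_antisymm hle (Finset.sum_nonneg hnn))
  set s : Set ι := {j | j ∈ b.support ∧ 0 < f j} with hs
  set q : Submodule ℝ M := Submodule.span ℝ (P.root '' s) with hq
  -- For a simple root outside the support of the expansion, the product with `P.root i` is
  -- nonnegative by dominance but is a sum of nonpositive terms, so each term is zero. This makes
  -- `q` stable under all simple reflections.
  have horth : ∀ j ∈ b.support, j ∉ s → ∀ k ∈ s, B (P.root k) (P.root j) = 0 := by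
    intro j hj hjs
    have hfj : f j = 0 := by
      by_contra hc
      exact hjs ⟨hj, lt_of_le_of_ne (hf₀ j) (Ne.symm hc)⟩
    have hnp : ∀ k ∈ b.support, (f k : ℝ) * B (P.root k) (P.root j) ≤ 0 := by
      intro k hk
      rcases eq_or_ne k j with rfl | hkj
      · simp [hfj]
      · have h1 := b.pairingIn_le_zero_of_ne hkj hk hj
        have h2 : B (P.root k) (P.root j) ≤ 0 := by
          by_contra! hc
          exact absurd ((hB _ _).mp hc) (not_lt.mpr h1)
        exact mul_nonpos_of_nonneg_of_nonpos (hf₀' k) h2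
    have hsum : 0 ≤ ∑ k ∈ b.support, (f k : ℝ) * B (P.root k) (P.root j) := by
      rw [← hexp, hsymm]; exact hBn i h j hj
    have := (Finset.sum_eq_zero_iff_of_nonpos hnp).mp
      (le_antisymm (Finset.sum_nonpos hnp) hsum)
    intro k hk
    rcases mul_eq_zero.mp (this k hk.1) with h0 | h0
    · have : f k = 0 := by exact_mod_cast h0
      exact absurd hk.2 (by lia)
    · exact h0
  have hinv : ∀ j ∈ b.support, q ∈ Module.End.invtSubmodule (P.reflection j : M →ₗ[ℝ] M) := by
    intro j hj
    by_cases hjs : j ∈ s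
    · have hjq : P.root j ∈ q := Submodule.subset_span ⟨j, hjs, rfl⟩
      rw [Module.End.mem_invtSubmodule]
      intro x hx
      change P.reflection j x ∈ q
      rw [RootPairing.reflection_apply]
      exact q.sub_mem hx (q.smul_mem _ hjq)
    · rw [Module.End.mem_invtSubmodule, hq, Submodule.span_le]
      rintro x hx
      obtain ⟨k, hk, rfl⟩ := hx
      have h0 := horth j hj hjs k hk
      have hp : P.pairingIn ℤ k j = 0 := by
        apply le_antisymm
        · by_contra! hc
          rw [← hB] at hc; linarith
        · by_contra! hc
          have : 0 < P.pairingIn ℤ k (P.reflectionPerm j j) := by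
            rw [RootPairing.pairingIn_reflectionPerm_self_right]; lia
          rw [← hB, root_neg, map_neg] at this
          linarith
      have : P.reflection j (P.root k) = P.root k := by
        rw [P.reflection_apply_root' ℤ, hp]; simp
      change P.reflection j (P.root k) ∈ Submodule.span ℝ (P.root '' s)
      rw [this]
      exact Submodule.subset_span (Set.mem_image_of_mem _ hk)
  have hqtop : q = ⊤ := by
    refine RootPairing.IsIrreducible.eq_top_of_invtSubmodule_reflection (P := P) q
      ((b.forall_mem_support_invtSubmodule_iff q).mp hinv) ?_
    intro hbot
    have : P.root i ∈ q := by
      rw [hf]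
      refine Submodule.sum_mem _ fun j hj ↦ ?_
      by_cases hjs : j ∈ s
      · have hjq : P.root j ∈ q := Submodule.subset_span ⟨j, hjs, rfl⟩
        exact zsmul_mem hjq _
      · have hfj : f j = 0 := by
          by_contra hc
          exact hjs ⟨hj, lt_of_le_of_ne (hf₀ j) (Ne.symm hc)⟩
        simp [hfj]
    rw [hbot, Submodule.mem_bot] at this
    exact P.ne_zero i this
  have hker : q ≤ LinearMap.ker (B (P.root i')) := by
    rw [hq, Submodule.span_le]
    rintro _ ⟨k, hk, rfl⟩
    change B (P.root i') (P.root k) = 0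
    rw [hsymm]
    rcases mul_eq_zero.mp (hzero k hk.1) with h0 | h0
    · have : f k = 0 := by exact_mod_cast h0
      exact absurd hk.2 (by lia)
    · exact h0
  have : P.root i' ∈ LinearMap.ker (B (P.root i')) := hker (hqtop ▸ Submodule.mem_top)
  exact (hpos i').ne' this

/-- A root of greatest height among those not below i has no root above it. If positive it is then a
maximal root, equal to i by uniqueness; if negative, its opposite lies above it. -/
lemma IsMaximalRoot.isHighestRoot [P.IsRootSystem] [P.IsReduced] [P.IsIrreducible] {b : P.Base}
    {i : ι} (h : IsMaximalRoot b i) : IsHighestRoot b i := by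
  by_contra hc
  have hbad : {j | j ≠ i ∧ ¬ RootLT b j i}.Nonempty := by
    by_contra he
    refine hc fun j hj ↦ ?_
    by_contra hj'
    exact he ⟨j, hj, hj'⟩
  obtain ⟨j, ⟨hji, hj⟩, hmax⟩ := Set.exists_max_image _ b.height (Set.toFinite _) hbad
  have key : ∀ k, RootLT b j k → False := by
    intro k hk
    rcases eq_or_ne k i with rfl | hki
    · exact hj hk
    · by_cases hki' : RootLT b k i
      · exact hj (hk.trans hki')
      · exact absurd (hmax k ⟨hki, hki'⟩) (not_le.mpr hk.height_lt)
  by_cases hjp : b.IsPos j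
  · refine hji (IsMaximalRoot.eq ⟨hjp, fun k hk l hl ↦ key l (.of_add hk hl)⟩ h)
  · have h1 := rootLT_neg ((isPos_neg_iff b j).mpr hjp)
    have h2 : P.reflectionPerm (P.reflectionPerm j j) (P.reflectionPerm j j) = j :=
      P.root.injective (by rw [root_neg, root_neg, neg_neg])
    rw [h2] at h1
    exact key _ h1

lemma exists_isHighestRoot [P.IsRootSystem] [P.IsReduced] [P.IsIrreducible] (b : P.Base) :
    ∃ i, IsHighestRoot b i := by
  have : Nontrivial M := RootPairing.IsIrreducible.nontrivial P
  have hne : Nonempty ι := by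
    by_contra hc
    rw [not_nonempty_iff] at hc
    have h := ‹P.IsRootSystem›.span_root_eq_top
    simp [Set.range_eq_empty] at h
  obtain ⟨i, hi⟩ := Finite.exists_max b.height
  have hip : b.IsPos i := by
    by_contra hc
    have := (isPos_neg_iff b i).mpr hc
    have h' := hi (P.reflectionPerm i i)
    rw [RootPairing.Base.isPos_iff] at *
    lia
  refine ⟨i, IsMaximalRoot.isHighestRoot ⟨hip, fun j hj k hk ↦ ?_⟩⟩
  have h1 := b.height_add hk
  have h2 := hi k
  rw [RootPairing.Base.isPos_iff] at hj
  lia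

end FiniteRootSystem
end ShiIdeal
end

noncomputable section
namespace ShiIdeal

/-! ### The linear action of the affine Weyl group and affine reflections. -/

section AffineAction

variable {ι M N : Type*} [AddCommGroup M] [Module ℝ M] [AddCommGroup N] [Module ℝ N]
  {P : RootPairing ι ℝ M N}

/-- The affine root `α + m δ` as the vector `(α, m)`. -/
def vec (a : AffineRoot P) : M × ℝ := (P.root a.1, (a.2 : ℝ))

lemma vec_injective : Function.Injective (vec (P := P)) := by
  rintro ⟨i, m⟩ ⟨j, n⟩ h
  have h1 : P.root i = P.root j := congrArg Prod.fst h
  have h2 : (m : ℝ) = n := congrArg Prod.snd h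
  exact Prod.ext (P.root.injective h1) (by exact_mod_cast h2)

lemma vec_opp (a : AffineRoot P) : vec a.opp = -vec a := by
  simp only [vec, AffineRoot.opp, root_neg, Int.cast_neg, Prod.neg_mk]

lemma opp_opp (a : AffineRoot P) : a.opp.opp = a :=
  vec_injective (by rw [vec_opp, vec_opp, neg_neg])

/-- Invariance of the pairing under the Weyl group; this is what makes `affineLinear`
multiplicative. -/
lemma toLinearMap_smul_weylOnCorootLattice (g : P.weylGroup) (x : M) (l : P.corootSpan ℤ) :
    P.toLinearMap (g • x) (weylOnCorootLattice P g l : N) = P.toLinearMap x (l : N) := by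
  have h := RootPairing.Equiv.coweightMap_coweightEquiv_symm P P (g : P.Aut) (l : N)
  have h1 := DFunLike.congr_fun (RootPairing.Hom.weight_coweight_transpose_apply P P
    (weylOnCorootLattice P g l : N) (g : P.Aut).toHom) x
  calc P.toLinearMap (g • x) (weylOnCorootLattice P g l : N)
      = P.toLinearMap x ((g : P.Aut).toHom.coweightMap (weylOnCorootLattice P g l : N)) := h1
    _ = P.toLinearMap x (l : N) := congrArg (P.toLinearMap x) h

lemma weylOnCorootLattice_mul (g h : P.weylGroup) (l : P.corootSpan ℤ) :
    weylOnCorootLattice P (g * h) l = weylOnCorootLattice P g (weylOnCorootLattice P h l) :=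
  DFunLike.congr_fun (map_mul (weylHom P) g h) (Multiplicative.ofAdd l)

lemma transPart_mul (w u : AffineWeylGroup P) :
    transPart (w * u) = weylOnCorootLattice P (finPart u)⁻¹ (transPart w) + transPart u := by
  have : Multiplicative.toAdd (w * u).left = Multiplicative.toAdd w.left +
      weylOnCorootLattice P w.right (Multiplicative.toAdd u.left) := rfl
  simp only [transPart, this, map_add, finPart]
  rw [← weylOnCorootLattice_mul, ← weylOnCorootLattice_mul]
  simp [SemidirectProduct.mul_right]

variable [P.IsCrystallographic]

/-- The linear action of `W_a` on the span of the affine roots. -/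
def affineLinear (w : AffineWeylGroup P) : (M × ℝ) →ₗ[ℝ] (M × ℝ) where
  toFun x := (finPart w • x.1, x.2 + P.toLinearMap x.1 (transPart w : N))
  map_add' x y := by
    ext <;> simp [smul_add]
    ring
  map_smul' c x := by
    ext <;> simp [smul_comm]
    ring

omit [P.IsCrystallographic] in
lemma affineLinear_mul (w u : AffineWeylGroup P) (x : M × ℝ) :
    affineLinear (w * u) x = affineLinear w (affineLinear u x) := by
  refine Prod.ext ?_ ?_
  · exact mul_smul (finPart w) (finPart u) x.1
  · have h := toLinearMap_smul_weylOnCorootLattice (finPart u) x.1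
      (weylOnCorootLattice P (finPart u)⁻¹ (transPart w))
    rw [← weylOnCorootLattice_mul, mul_inv_cancel] at h
    have h1 : weylOnCorootLattice P 1 (transPart w) = transPart w :=
      DFunLike.congr_fun (map_one (weylHom P)) (Multiplicative.ofAdd (transPart w))
    rw [h1] at h
    change x.2 + P.toLinearMap x.1 (transPart (w * u) : N) =
      (x.2 + P.toLinearMap x.1 (transPart u : N)) + P.toLinearMap (finPart u • x.1) (transPart w : N)
    rw [h, transPart_mul, Submodule.coe_add, map_add]
    ring

lemma affineLinear_vec (w : AffineWeylGroup P) (a : AffineRoot P) :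
    affineLinear w (vec a) = vec (act w a) := by
  refine Prod.ext ?_ ?_
  · exact P.weylGroup_apply_root _ _
  · have h : ((P.root'In ℤ a.1 (transPart w) : ℤ) : ℝ) = P.root' a.1 (transPart w : N) :=
      P.algebraMap_root'In_apply ℤ a.1 (transPart w)
    change (a.2 : ℝ) + P.root' a.1 (transPart w : N) =
      ((a.2 + P.root'In ℤ a.1 (transPart w) : ℤ) : ℝ)
    rw [Int.cast_add, h]

lemma act_mul (w u : AffineWeylGroup P) (a : AffineRoot P) : act (w * u) a = act w (act u a) :=
  vec_injective (by simp only [← affineLinear_vec, affineLinear_mul])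

lemma act_one (a : AffineRoot P) : act (1 : AffineWeylGroup P) a = a := by
  have h : transPart (1 : AffineWeylGroup P) = 0 := map_zero _
  have h' : finPart (1 : AffineWeylGroup P) = 1 := rfl
  simp [act, h, h']

lemma act_inv_act (w : AffineWeylGroup P) (a : AffineRoot P) : act w⁻¹ (act w a) = a := by
  rw [← act_mul, inv_mul_cancel, act_one]

lemma act_act_inv (w : AffineWeylGroup P) (a : AffineRoot P) : act w (act w⁻¹ a) = a := by
  rw [← act_mul, mul_inv_cancel, act_one]

lemma act_opp (w : AffineWeylGroup P) (a : AffineRoot P) : act w a.opp = (act w a).opp :=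
  vec_injective (by rw [vec_opp, ← affineLinear_vec, ← affineLinear_vec, vec_opp, map_neg])

omit [P.IsCrystallographic] in
lemma affineLinear_one (x : M × ℝ) : affineLinear (1 : AffineWeylGroup P) x = x := by
  have h : transPart (1 : AffineWeylGroup P) = 0 := map_zero _
  refine Prod.ext (one_smul P.weylGroup x.1) ?_
  change x.2 + P.toLinearMap x.1 (transPart (1 : AffineWeylGroup P) : N) = x.2
  rw [h]
  simp

omit [P.IsCrystallographic] in
lemma affineLinear_delta (w : AffineWeylGroup P) : affineLinear w (0, 1) = (0, 1) := by
  refine Prod.ext (smul_zero (finPart w)) ?_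
  change (1 : ℝ) + P.toLinearMap 0 _ = 1
  simp

/-- Faithfulness, used to check identities between group elements on affine roots. -/
lemma act_injective [P.IsRootSystem] :
    Function.Injective (act : AffineWeylGroup P → AffineRoot P → AffineRoot P) := by
  intro w u h
  have hf : finPart w = finPart u := by
    have hp : ∀ i, P.weylGroupToPerm (finPart w) i = P.weylGroupToPerm (finPart u) i :=
      fun i ↦ congrArg Prod.fst (congrFun h (i, 0))
    refine Subtype.ext (RootPairing.Equiv.weightHom_injective P (LinearEquiv.toLinearMap_injective
      (LinearMap.ext_on_range ‹P.IsRootSystem›.span_root_eq_top fun i ↦ ?_)))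
    have h1 := P.weylGroup_apply_root (finPart w) i
    rw [hp, ← P.weylGroup_apply_root] at h1
    exact h1
  have ht : transPart w = transPart u := by
    refine Subtype.ext (P.flip.toPerfPair.injective
      (LinearMap.ext_on_range ‹P.IsRootSystem›.span_root_eq_top fun i ↦ ?_))
    have h1 := congrArg vec (congrFun h (i, 0))
    rw [← affineLinear_vec, ← affineLinear_vec] at h1
    have h2 := congrArg Prod.snd h1
    change ((0 : ℤ) : ℝ) + P.toLinearMap (P.root i) (transPart w : N) =
      ((0 : ℤ) : ℝ) + P.toLinearMap (P.root i) (transPart u : N) at h2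
    exact add_left_cancel h2
  rw [eq_ofWeyl_mul_translation w, eq_ofWeyl_mul_translation u, hf, ht]

/-- The reflection in the affine root `α + m δ`. -/
def affineReflection (a : AffineRoot P) : AffineWeylGroup P :=
  ofWeyl (RootPairing.weylGroup.ofIdx P a.1) * translation (-(a.2 • P.corootSpanMem ℤ a.1))

omit [P.IsCrystallographic] in
lemma finPart_affineReflection (a : AffineRoot P) :
    finPart (affineReflection a) = RootPairing.weylGroup.ofIdx P a.1 := mul_one _

omit [P.IsCrystallographic] in
lemma transPart_affineReflection (a : AffineRoot P) :
    transPart (affineReflection a) = -(a.2 • P.corootSpanMem ℤ a.1) := by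
  have h1 : transPart (ofWeyl (RootPairing.weylGroup.ofIdx P a.1)) = 0 := map_zero _
  have h2 : ∀ l : P.corootSpan ℤ, transPart (translation l) = l := fun l ↦ by
    change weylOnCorootLattice P 1⁻¹ l = l
    rw [inv_one]
    exact DFunLike.congr_fun (map_one (weylHom P)) (Multiplicative.ofAdd l)
  rw [affineReflection, transPart_mul, h1, h2, map_zero, zero_add]

lemma act_affineReflection (a c : AffineRoot P) : act (affineReflection a) c =
    (P.reflectionPerm a.1 c.1, c.2 - P.pairingIn ℤ c.1 a.1 * a.2) := by
  refine Prod.ext ?_ ?_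
  · simp only [act, finPart_affineReflection]
    rfl
  · simp only [act, transPart_affineReflection, map_neg, map_zsmul,
      RootPairing.root'In_corootSpanMem_eq_pairingIn, smul_eq_mul]
    ring

lemma vec_act_affineReflection (a c : AffineRoot P) :
    vec (act (affineReflection a) c) = vec c - P.pairingIn ℤ c.1 a.1 • vec a := by
  rw [act_affineReflection]
  refine Prod.ext ?_ ?_
  · simp only [vec, RootPairing.root_reflectionPerm, P.reflection_apply_root' ℤ, Prod.fst_sub,
      Prod.smul_mk]
  · simp [vec]

lemma pairingIn_weylGroupToPerm (g : P.weylGroup) (i j : ι) :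
    P.pairingIn ℤ (P.weylGroupToPerm g i) (P.weylGroupToPerm g j) = P.pairingIn ℤ i j := by
  obtain ⟨g, hg⟩ := g
  induction hg using RootPairing.weylGroup.induction generalizing i j with
  | mem k =>
    change P.pairingIn ℤ (P.reflectionPerm k i) (P.reflectionPerm k j) = _
    rw [RootPairing.pairingIn_reflectionPerm, RootPairing.reflectionPerm_self]
  | one => rfl
  | mul x y hx hy ihx ihy =>
    exact (ihx _ _).trans (ihy i j)

/-- The formula s_{wa} = w s_a w⁻¹, which follows from the invariance of the Cartan integers. -/
lemma affineReflection_act [P.IsRootSystem] (w : AffineWeylGroup P) (a : AffineRoot P) :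
    affineReflection (act w a) = w * affineReflection a * w⁻¹ := by
  rw [eq_mul_inv_iff_mul_eq]
  refine act_injective (funext fun c ↦ vec_injective ?_)
  rw [act_mul, act_mul, vec_act_affineReflection, ← affineLinear_vec w (act _ c),
    vec_act_affineReflection, map_sub, map_zsmul, affineLinear_vec, affineLinear_vec]
  congr 2
  exact pairingIn_weylGroupToPerm _ _ _

lemma affineReflection_mul_self [P.IsRootSystem] (a : AffineRoot P) :
    affineReflection a * affineReflection a = 1 := by
  refine act_injective (funext fun c ↦ ?_)
  rw [act_mul, act_one, act_affineReflection, act_affineReflection]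
  refine Prod.ext (by simp) ?_
  simp only
  rw [← RootPairing.pairingIn_reflectionPerm, RootPairing.pairingIn_reflectionPerm_self_right]
  ring

lemma act_affineReflection_self (a : AffineRoot P) : act (affineReflection a) a = a.opp := by
  rw [act_affineReflection]
  refine Prod.ext rfl ?_
  simp only [AffineRoot.opp, RootPairing.pairingIn_same]
  ring

lemma affineReflection_opp [P.IsRootSystem] (a : AffineRoot P) :
    affineReflection a.opp = affineReflection a := by
  refine act_injective (funext fun c ↦ vec_injective ?_)
  rw [vec_act_affineReflection, vec_act_affineReflection, vec_opp]
  simp [AffineRoot.opp]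

end AffineAction
end ShiIdeal
end

noncomputable section
namespace ShiIdeal

/-! ### Positive affine roots, generation by simple reflections, and length. -/

section AffinePositive

variable {ι M N : Type*} [AddCommGroup M] [Module ℝ M] [AddCommGroup N] [Module ℝ N]
  {P : RootPairing ι ℝ M N} {b : P.Base}

lemma isPosAffine_iff {a : AffineRoot P} :
    IsPosAffine b a ↔ 0 < a.2 ∨ (a.2 = 0 ∧ ¬ b.IsPos a.1) := by
  rw [IsPosAffine, isPos_neg_iff]
  by_cases h : b.IsPos a.1 <;> simp only [h] <;> grind

lemma isPosAffine_opp {a : AffineRoot P} : IsPosAffine b a.opp ↔ ¬ IsPosAffine b a := by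
  rw [isPosAffine_iff, isPosAffine_iff]
  simp only [AffineRoot.opp, isPos_neg_iff]
  by_cases h : b.IsPos a.1 <;> simp only [h] <;> grind

lemma IsSimpleAffine.isPosAffine [P.IsRootSystem] {β : AffineRoot P} (h : IsSimpleAffine b β) :
    IsPosAffine b β := by
  rw [isPosAffine_iff]
  rcases h with ⟨h, h0⟩ | ⟨-, h1⟩
  · exact .inr ⟨h0, (isPos_neg_iff b _).mp (b.isPos_of_mem_support h)⟩
  · exact .inl (by lia)

variable [Finite ι] [P.IsCrystallographic] [P.IsReduced] [P.IsRootSystem]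

-- If ⟨β, θ⟩ ≥ 2, then θ - β is a positive root with ⟨θ - β, θ⟩ ≤ 0, and dominance of θ forces
-- equality. Then -s_θ(β) = θ + (θ - β) is a root above θ.
omit [P.IsReduced] in
lemma IsHighestRoot.pairingIn_le_one {i j : ι} (h : IsHighestRoot b i) (hj : j ≠ i) :
    P.pairingIn ℤ j i ≤ 1 := by
  by_contra! hc
  have hmax := h.isMaximalRoot
  have hc' : 0 < P.pairingIn ℤ i j := (P.zero_lt_pairingIn_iff' ℤ).mp (by lia)
  obtain ⟨k, hk⟩ := P.root_sub_root_mem_of_pairingIn_pos hc' hj.symm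
  have hkp : b.IsPos k := by
    have h1 := (h j hj).height_lt
    rw [RootPairing.Base.isPos_iff, b.height_sub hk]
    lia
  have hpk : P.pairingIn ℤ k i = 2 - P.pairingIn ℤ j i := by
    have := P.pairingIn_eq_add_of_root_eq_add (S := ℤ) (i := k) (j := i) (k := i) (l := j)
      (by rw [hk]; abel)
    rw [P.pairingIn_same] at this
    lia
  by_cases hc2 : P.pairingIn ℤ j i = 2
  · refine hmax.2 k hkp (P.reflectionPerm (P.reflectionPerm i j) (P.reflectionPerm i j)) ?_
    rw [root_neg, P.root_reflectionPerm, P.reflection_apply_root' ℤ, hc2, hk]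
    module
  · have h4 := hmax.pairingIn_nonneg hkp
    rw [← not_lt, P.pairingIn_lt_zero_iff] at h4
    exact h4 (by lia)

/-- A simple reflection permutes the positive affine roots other than the simple one. -/
lemma IsSimpleAffine.isPosAffine_act {β a : AffineRoot P} (hβ : IsSimpleAffine b β)
    (ha : IsPosAffine b a) (hne : a ≠ β) : IsPosAffine b (act (affineReflection β) a) := by
  obtain ⟨k, n⟩ := β
  obtain ⟨i, m⟩ := a
  rw [isPosAffine_iff] at ha
  rw [act_affineReflection, isPosAffine_iff]
  rcases hβ with ⟨hk, hn⟩ | ⟨hk, hn⟩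
  · simp only at hk hn ha ⊢
    subst hn
    rw [mul_zero, sub_zero]
    rcases ha with ha | ⟨rfl, ha⟩
    · exact .inl ha
    · refine .inr ⟨rfl, ?_⟩
      have hne' : P.reflectionPerm i i ≠ P.reflectionPerm k k := by
        intro h
        have := congrArg P.root h
        rw [root_neg, root_neg, neg_inj] at this
        exact hne (Prod.ext (P.root.injective this) rfl)
      have h1 := ((isPos_neg_iff b i).mpr ha).reflectionPerm hk hne'
      have h2 : P.reflectionPerm (P.reflectionPerm k k) (P.reflectionPerm i i) =
          P.reflectionPerm (P.reflectionPerm k i) (P.reflectionPerm k i) := by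
        refine P.root.injective ?_
        rw [root_neg, P.root_reflectionPerm, P.root_reflectionPerm k i,
          P.reflection_apply_root' ℤ, P.reflection_apply_root' ℤ, root_neg, root_neg]
        simp only [RootPairing.pairingIn_reflectionPerm_self_left,
          RootPairing.pairingIn_reflectionPerm_self_right]
        module
      rw [h2, isPos_neg_iff] at h1
      exact h1
  · simp only at hk hn ha ⊢
    subst hn
    rw [mul_one]
    have hroot := P.root_reflectionPerm k i
    rw [P.reflection_apply_root' ℤ] at hroot
    by_cases hi : b.IsPos i
    · have hm : 0 < m := by grind
      rcases eq_or_ne i k with rfl | hik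
      · have hm1 : m ≠ 1 := by rintro rfl; exact hne rfl
        rw [P.pairingIn_same, isPos_neg_iff]
        grind
      · have h1 := hk.pairingIn_le_one hik
        -- The level can drop to zero only for i + δ with pairing 1; the image is then i - θ at
        -- level zero, whose finite part is negative.
        rcases (show 0 < m - P.pairingIn ℤ i k ∨ P.pairingIn ℤ i k = 1 ∧ m = 1 by lia) with h | h
        · exact .inl h
        · refine .inr ⟨by lia, ?_⟩
          rw [h.1, one_smul] at hroot
          have h2 := (hk i hik).height_lt
          rw [RootPairing.Base.isPos_iff, b.height_sub hroot]
          lia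
    · have h1 := hk.isMaximalRoot.pairingIn_nonneg ((isPos_neg_iff b i).mpr hi)
      rw [RootPairing.pairingIn_reflectionPerm_self_right] at h1
      have h2 : P.pairingIn ℤ i k ≤ 0 := by
        by_contra! hc
        rw [P.zero_lt_pairingIn_iff'] at hc
        lia
      rcases (show 0 < m - P.pairingIn ℤ i k ∨ P.pairingIn ℤ i k = 0 ∧ m = 0 by grind) with h | h
      · exact .inl h
      · refine .inr ⟨by lia, ?_⟩
        rw [h.1, zero_smul, sub_zero] at hroot
        rwa [P.root.injective hroot]

variable [P.IsIrreducible]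

-- Either some simple α pairs negatively with i, and -α works, or i is dominant. In that case θ - i
-- is zero or a sum of positive roots, so the product of θ and i is at least that of i with itself.
variable (b) in
lemma exists_isSimpleAffine_pairingIn_pos (i : ι) :
    ∃ β, IsSimpleAffine b β ∧ 0 < P.pairingIn ℤ i β.1 := by
  by_cases hdom : ∀ j ∈ b.support, 0 ≤ P.pairingIn ℤ i j
  · obtain ⟨θ, hθ⟩ := exists_isHighestRoot b
    refine ⟨(θ, 1), .inr ⟨hθ, rfl⟩, ?_⟩
    rcases eq_or_ne i θ with rfl | hiθ
    · simp
    obtain ⟨B, hsymm, hpos, hB⟩ := exists_invariant_form P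
    have hsimple : ∀ j ∈ b.support, 0 ≤ B (P.root j) (P.root i) := by
      intro j hj
      by_contra! hc
      have h2 : 0 < B (P.root (P.reflectionPerm j j)) (P.root i) := by
        rw [root_neg, map_neg, LinearMap.neg_apply]; linarith
      rw [hsymm, hB, RootPairing.pairingIn_reflectionPerm_self_right] at h2
      have := hdom j hj
      lia
    have hposr : ∀ j, b.IsPos j → 0 ≤ B (P.root j) (P.root i) := by
      intro j hj
      obtain ⟨f, hf₀, hf⟩ := exists_nonneg_coeff hj
      rw [hf]
      simp only [map_sum, map_zsmul, LinearMap.sum_apply, LinearMap.smul_apply, zsmul_eq_mul]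
      exact Finset.sum_nonneg fun k hk ↦ mul_nonneg (by exact_mod_cast hf₀ k) (hsimple k hk)
    have hcl : ∀ x ∈ AddSubsemigroup.closure (P.root '' {k | b.IsPos k}),
        0 ≤ B x (P.root i) := by
      intro x hx
      induction hx using AddSubsemigroup.closure_induction with
      | mem x hx =>
        obtain ⟨k, hk, rfl⟩ := hx
        exact hposr k hk
      | add x y _ _ hx hy =>
        rw [map_add, LinearMap.add_apply]
        exact add_nonneg hx hy
    have h1 := hcl _ (hθ i hiθ)
    rw [map_sub, LinearMap.sub_apply] at h1
    rw [← hB, hsymm]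
    linarith [hpos i]
  · push Not at hdom
    obtain ⟨j, hj, hij⟩ := hdom
    refine ⟨(P.reflectionPerm j j, 0), .inl ⟨?_, rfl⟩, ?_⟩
    · have : P.reflectionPerm (P.reflectionPerm j j) (P.reflectionPerm j j) = j :=
        P.root.injective (by rw [root_neg, root_neg, neg_neg])
      simpa only [this] using hj
    · rw [RootPairing.pairingIn_reflectionPerm_self_right]
      lia

omit [Finite ι] [P.IsReduced] [P.IsIrreducible] in
lemma affineReflection_mem_simpleReflections {β : AffineRoot P} (h : IsSimpleAffine b β) :
    affineReflection β ∈ simpleReflections b := by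
  rcases h with ⟨h, h0⟩ | ⟨h, h1⟩
  · refine .inl ⟨_, h, ?_⟩
    rw [← affineReflection_opp, affineReflection, AffineRoot.opp, h0]
    have : translation (P := P) (-(-0 • P.corootSpanMem ℤ (P.reflectionPerm β.1 β.1))) = 1 := by
      rw [neg_zero, zero_smul, neg_zero]
      rfl
    rw [this, mul_one]
  · refine .inr ⟨_, h, ?_⟩
    rw [affineReflection, h1, one_smul]

omit [Finite ι] [P.IsReduced] [P.IsIrreducible] in
lemma exists_eq_affineReflection {s : AffineWeylGroup P} (hs : s ∈ simpleReflections b) :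
    ∃ β, IsSimpleAffine b β ∧ s = affineReflection β := by
  rcases hs with ⟨i, hi, rfl⟩ | ⟨i, hi, rfl⟩
  · refine ⟨(P.reflectionPerm i i, 0), .inl ⟨?_, rfl⟩, ?_⟩
    · have : P.reflectionPerm (P.reflectionPerm i i) (P.reflectionPerm i i) = i :=
        P.root.injective (by rw [root_neg, root_neg, neg_neg])
      simpa only [this] using hi
    · have : (P.reflectionPerm i i, 0) = AffineRoot.opp (P := P) (i, 0) := rfl
      rw [this, affineReflection_opp, affineReflection]
      have : translation (P := P) (-((0 : ℤ) • P.corootSpanMem ℤ i)) = 1 := by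
        rw [zero_smul, neg_zero]
        rfl
      rw [this, mul_one]
  · refine ⟨(i, 1), .inr ⟨hi, rfl⟩, ?_⟩
    rw [affineReflection, one_smul]

lemma affineReflection_mem_closure {a : AffineRoot P} (ha : IsPosAffine b a) :
    affineReflection a ∈ Subgroup.closure (simpleReflections b) := by
  obtain ⟨θ, hθ⟩ := exists_isHighestRoot b
  -- With this constant the linear function `H` is positive on positive affine roots, so it
  -- decreases when a simple reflection with positive pairing is applied.
  set C := b.height θ + 1 with hC
  set H : AffineRoot P → ℤ := fun a ↦ a.2 * C - b.height a.1 with hH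
  have hHpos : ∀ a, IsPosAffine b a → 0 < H a := by
    rintro ⟨i, m⟩ h
    have hθp := hθ.isPos
    rw [RootPairing.Base.isPos_iff] at hθp
    have hle : b.height i ≤ b.height θ := by
      rcases eq_or_ne i θ with rfl | h
      · exact le_rfl
      · exact (hθ i h).height_lt.le
    rw [isPosAffine_iff] at h
    simp only [hH]
    rcases h with h | ⟨h, hi⟩
    · simp only at h
      nlinarith
    · rw [RootPairing.Base.isPos_iff'] at hi
      simp only at h
      rw [h]
      lia
  induction hn : (H a).toNat using Nat.strong_induction_on generalizing a with
  | _ n ih =>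
    obtain ⟨β, hβ, hp⟩ := exists_isSimpleAffine_pairingIn_pos b a.1
    have hβmem := Subgroup.subset_closure (affineReflection_mem_simpleReflections hβ)
    rcases eq_or_ne a β with rfl | hne
    · exact hβmem
    have hpos := hβ.isPosAffine_act ha hne
    have hlt : H (act (affineReflection β) a) < H a := by
      have h1 := P.root_reflectionPerm β.1 a.1
      rw [P.reflection_apply_root' ℤ, sub_eq_add_neg, ← neg_smul] at h1
      have h2 := b.height_add_zsmul h1
      have h3 := hHpos β hβ.isPosAffine
      rw [act_affineReflection]
      simp only [hH] at h3 ⊢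
      rw [h2, smul_eq_mul]
      nlinarith
    have h4 := ih _ (by have := hHpos _ ha; have := hHpos _ hpos; lia) hpos rfl
    rw [affineReflection_act] at h4
    have h5 := mul_mem (mul_mem (inv_mem hβmem) h4) hβmem
    have h6 : (affineReflection β)⁻¹ * (affineReflection β * affineReflection a *
      (affineReflection β)⁻¹) * affineReflection β = affineReflection a := by group
    rwa [h6] at h5

variable (b) in
lemma closure_simpleReflections : Subgroup.closure (simpleReflections b) = ⊤ := by
  have hall : ∀ a, affineReflection a ∈ Subgroup.closure (simpleReflections b) := by
    intro a
    by_cases ha : IsPosAffine b a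
    · exact affineReflection_mem_closure ha
    · rw [← affineReflection_opp]
      exact affineReflection_mem_closure (isPosAffine_opp.mpr ha)
  have hfin : ∀ i, ofWeyl (RootPairing.weylGroup.ofIdx P i) = affineReflection (i, 0) := by
    intro i
    rw [affineReflection]
    have : translation (P := P) (-((0 : ℤ) • P.corootSpanMem ℤ i)) = 1 := by
      rw [zero_smul, neg_zero]
      rfl
    rw [this, mul_one]
  have htrans : ∀ l : P.corootSpan ℤ,
      translation l ∈ Subgroup.closure (simpleReflections b) := by
    rintro ⟨l, hl⟩
    have hadd : ∀ x y : P.corootSpan ℤ, translation (x + y) = translation x * translation y :=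
      fun x y ↦ map_mul SemidirectProduct.inl (Multiplicative.ofAdd x) (Multiplicative.ofAdd y)
    have hzero : translation (0 : P.corootSpan ℤ) = 1 := rfl
    have hneg : ∀ x : P.corootSpan ℤ, translation (-x) = (translation x)⁻¹ := fun x ↦ by
      rw [eq_inv_iff_mul_eq_one, ← hadd, neg_add_cancel, hzero]
    have hroot : ∀ i, translation (P.corootSpanMem ℤ i) ∈
        Subgroup.closure (simpleReflections b) := by
      intro i
      -- A translation by a coroot is the product of the reflections in two parallel hyperplanes.
      have h1 : translation (P.corootSpanMem ℤ i) =
          (affineReflection (i, 0))⁻¹ * affineReflection (i, -1) := by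
        rw [← hfin, affineReflection]
        simp
      rw [h1]
      exact mul_mem (inv_mem (hall _)) (hall _)
    induction hl using Submodule.span_induction with
    | mem x hx =>
      obtain ⟨i, rfl⟩ := hx
      exact hroot i
    | zero => exact one_mem _
    | add x y hx hy ihx ihy =>
      have := mul_mem ihx ihy
      rwa [← hadd] at this
    | smul t x hx ih =>
      induction t using Int.induction_on with
      | zero =>
        simp only [zero_smul]
        exact one_mem _
      | succ t iht =>
        have := mul_mem iht ih
        rw [← hadd] at this
        convert this using 2
        exact Subtype.ext (by simp [add_smul])
      | pred t iht =>
        have := mul_mem iht (inv_mem ih)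
        rw [← hneg, ← hadd] at this
        convert this using 2
        refine Subtype.ext ?_
        change (-(t : ℤ) - 1) • x = -(t : ℤ) • x + -x
        module
  have hweyl : ∀ g : P.weylGroup, ofWeyl g ∈ Subgroup.closure (simpleReflections b) := by
    rintro ⟨g, hg⟩
    induction hg using RootPairing.weylGroup.induction with
    | mem i =>
      have := hall (i, 0)
      rwa [← hfin] at this
    | one => exact one_mem _
    | mul x y hx hy ihx ihy =>
      have h : ofWeyl (⟨x * y, mul_mem hx hy⟩ : P.weylGroup) = ofWeyl ⟨x, hx⟩ * ofWeyl ⟨y, hy⟩ :=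
        map_mul (SemidirectProduct.inr (φ := weylHom P)) (⟨x, hx⟩ : P.weylGroup) ⟨y, hy⟩
      rw [h]
      exact mul_mem ihx ihy
  rw [eq_top_iff]
  intro w _
  rw [eq_ofWeyl_mul_translation w]
  exact mul_mem (hweyl _) (htrans _)

variable (b) in
lemma exists_word (w : AffineWeylGroup P) :
    ∃ l : List (AffineWeylGroup P), (∀ s ∈ l, s ∈ simpleReflections b) ∧ l.prod = w := by
  have hw : w ∈ (Subgroup.closure (simpleReflections b)).toSubmonoid := by
    simp [closure_simpleReflections]
  rw [Subgroup.closure_toSubmonoid] at hw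
  obtain ⟨l, hl, rfl⟩ := Submonoid.exists_list_of_mem_closure hw
  refine ⟨l, fun s hs ↦ ?_, rfl⟩
  rcases hl s hs with h | h
  · exact h
  · obtain ⟨β, hβ, he⟩ := exists_eq_affineReflection h
    have : s = s⁻¹ := by
      rw [eq_inv_iff_mul_eq_one, ← inv_inj, mul_inv_rev, he, affineReflection_mul_self, inv_one]
    rw [this]
    exact h

omit [P.IsIrreducible] in
/-- The exchange property. -/
lemma exists_shorter_word {β : AffineRoot P} (hβ : IsSimpleAffine b β)
    (l : List (AffineWeylGroup P)) (hl : ∀ s ∈ l, s ∈ simpleReflections b)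
    (hneg : ¬ IsPosAffine b (act l.prod β)) :
    ∃ l' : List (AffineWeylGroup P), (∀ s ∈ l', s ∈ simpleReflections b) ∧
      l'.prod = l.prod * affineReflection β ∧ l'.length < l.length := by
  induction l with
  | nil =>
    rw [List.prod_nil, act_one] at hneg
    exact absurd hβ.isPosAffine hneg
  | cons s l ih =>
    have hs := hl s (by simp)
    have hl' : ∀ s ∈ l, s ∈ simpleReflections b := fun s h ↦ hl s (by simp [h])
    by_cases hc : IsPosAffine b (act l.prod β)
    · obtain ⟨γ, hγ, rfl⟩ := exists_eq_affineReflection hs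
      rw [List.prod_cons, act_mul] at hneg
      -- The reflection in γ makes only γ negative among positive affine roots. Conjugation then
      -- turns the letter s_γ into s_β on the right, where it cancels.
      have he : act l.prod β = γ := by
        by_contra hne
        exact hneg (hγ.isPosAffine_act hc hne)
      refine ⟨l, hl', ?_, by simp⟩
      rw [List.prod_cons, ← he, affineReflection_act]
      have := affineReflection_mul_self β
      rw [inv_mul_cancel_right, mul_assoc, this, mul_one]
    · obtain ⟨l', h₁, h₂, h₃⟩ := ih hl' hc
      refine ⟨s :: l', ?_, ?_, by simpa⟩
      · intro t ht
        rcases List.mem_cons.mp ht with rfl | ht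
        · exact hs
        · exact h₁ t ht
      · rw [List.prod_cons, h₂, List.prod_cons, mul_assoc]

lemma length_mul_lt {β : AffineRoot P} (hβ : IsSimpleAffine b β) {w : AffineWeylGroup P}
    (hneg : ¬ IsPosAffine b (act w β)) : length b (w * affineReflection β) < length b w := by
  have hne : {n | ∃ l : List (AffineWeylGroup P),
      (∀ s ∈ l, s ∈ simpleReflections b) ∧ l.prod = w ∧ l.length = n}.Nonempty := by
    obtain ⟨l, hl, h⟩ := exists_word b w
    exact ⟨_, l, hl, h, rfl⟩
  obtain ⟨l, hl, rfl, hlen⟩ := Nat.sInf_mem hne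
  obtain ⟨l', h₁, h₂, h₃⟩ := exists_shorter_word hβ l hl hneg
  calc length b (l.prod * affineReflection β) ≤ l'.length := Nat.sInf_le ⟨l', h₁, h₂, rfl⟩
    _ < l.length := h₃
    _ = length b l.prod := hlen

lemma lt_length_mul {β : AffineRoot P} (hβ : IsSimpleAffine b β) {w : AffineWeylGroup P}
    (hpos : IsPosAffine b (act w β)) : length b w < length b (w * affineReflection β) := by
  have h := length_mul_lt hβ (w := w * affineReflection β) (by
    rw [act_mul, act_affineReflection_self, act_opp, isPosAffine_opp, not_not]
    exact hpos)
  rwa [mul_assoc, affineReflection_mul_self, mul_one] at h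

-- Since s_β permutes the positive affine roots other than β, the sets N(w) and N(w s_β) differ at
-- most in the roots ±wβ.
omit [P.IsIrreducible] in
lemma isPosAffine_act_mul_inv_iff {β : AffineRoot P} (hβ : IsSimpleAffine b β)
    {w : AffineWeylGroup P} {a : AffineRoot P} (h₁ : a ≠ act w β) (h₂ : a ≠ (act w β).opp) :
    IsPosAffine b (act (w * affineReflection β)⁻¹ a) ↔ IsPosAffine b (act w⁻¹ a) := by
  have hs : (affineReflection β)⁻¹ = affineReflection β := by
    rw [inv_eq_iff_mul_eq_one, affineReflection_mul_self]
  rw [mul_inv_rev, act_mul, hs]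
  have h₁' : act w⁻¹ a ≠ β := by rintro rfl; exact h₁ (act_act_inv w a).symm
  have h₂' : (act w⁻¹ a).opp ≠ β := by
    intro h
    refine h₂ ?_
    rw [← h, act_opp, opp_opp, act_act_inv]
  refine ⟨fun h ↦ ?_, fun h ↦ hβ.isPosAffine_act h h₁'⟩
  by_contra hc
  have := hβ.isPosAffine_act (isPosAffine_opp.mpr hc) h₂'
  rw [act_opp, isPosAffine_opp] at this
  exact this h

end AffinePositive
end ShiIdeal
end

noncomputable section
namespace ShiIdeal

/-! ### Moving positive systems along additive automorphisms. -/

section Transport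

variable {E : Type*} [AddCommGroup E] {R P : Set E} {d : E}

lemma IsPositiveSystem.comap (hP : IsPositiveSystem R P) (f : E ≃+ E) (hf : ∀ x ∈ R, f x ∈ R) :
    IsPositiveSystem R {x | x ∈ R ∧ f x ∈ P} where
  subset _ h := h.1
  neg_mem := hP.neg_mem
  total x hx := (hP.total _ (hf x hx)).imp (fun h ↦ ⟨hx, h⟩)
    (fun h ↦ ⟨hP.neg_mem x hx, by rwa [map_neg]⟩)
  neg_notMem x hx h := hP.neg_notMem _ hx.2 (by rw [← map_neg]; exact h.2)
  add_mem x hx y hy h :=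
    ⟨h, by rw [map_add]; exact hP.add_mem _ hx.2 _ hy.2 (by rw [← map_add]; exact hf _ h)⟩

/-- The shift vector moves with `f`: it stays δ when `f` is the action of w⁻¹ and becomes -δ when
`f` is its negative. -/
lemma HasSimpleInduction.comap {S : Set E} (hP : HasSimpleInduction P S d) (hPR : P ⊆ R)
    (f : E ≃+ E) (hf : ∀ x ∈ R, f.symm x ∈ R) :
    HasSimpleInduction {x | x ∈ R ∧ f x ∈ P} {x | f x ∈ S} (f.symm d) := by
  intro p hS hadd hd x hx
  have hmem : ∀ x ∈ P, f.symm x ∈ {x | x ∈ R ∧ f x ∈ P} :=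
    fun x hx ↦ ⟨hf x (hPR hx), by simpa⟩
  have := hP (fun x ↦ p (f.symm x)) (fun x hx ↦ hS _ (by simpa))
    (fun x hx y hy hxy ihx ihy ↦ by
      have h := hmem _ hxy
      rw [map_add] at h ⊢
      exact hadd _ (hmem x hx) _ (hmem y hy) h ihx ihy)
    (fun x hx j hj hxj ih ↦ by
      have h := hmem _ hxj
      rw [map_add, map_nsmul] at h ⊢
      exact hd _ (hmem x hx) j hj h ih) (f x) hx.2
  simpa using this

lemma HasExchange.neg (h : HasExchange R d) : HasExchange R (-d) := by
  have key : ∀ x : E, (∃ j : ℤ, x = j • d) → ∃ j : ℤ, x = j • -d := by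
    rintro _ ⟨j, rfl⟩
    exact ⟨-j, by simp⟩
  intro a ha b hb x hx y hy h₁ h₂
  exact (h a ha b hb x hx y hy h₁ h₂).imp (Or.imp_right (key _)) (Or.imp_right (key _))

end Transport

/-! ### The affine roots as an instance of the abstract setting. -/

section AffinePositiveSystem

variable {ι M N : Type*} [AddCommGroup M] [Module ℝ M] [AddCommGroup N] [Module ℝ N]
  {P : RootPairing ι ℝ M N} {b : P.Base}

variable (P) in
/-- The affine roots as vectors. -/
abbrev affineRootSet : Set (M × ℝ) := Set.range (vec (P := P))

variable (b) in
/-- The positive affine roots as vectors. -/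
def posSet : Set (M × ℝ) := vec '' {a : AffineRoot P | IsPosAffine b a}

/-- The imaginary root `δ`. -/
def delta : M × ℝ := (0, 1)

lemma vec_mem_posSet {a : AffineRoot P} : vec a ∈ posSet b ↔ IsPosAffine b a :=
  vec_injective.mem_set_image

lemma vec_eq_add_iff {a c e : AffineRoot P} :
    vec e = vec a + vec c ↔ P.root e.1 = P.root a.1 + P.root c.1 ∧ e.2 = a.2 + c.2 := by
  simp only [vec, Prod.mk_add_mk, Prod.mk.injEq]
  exact and_congr_right fun _ ↦ by rw [← Int.cast_add, Int.cast_inj]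

lemma vec_add_zsmul_delta (i : ι) (m j : ℤ) :
    vec (P := P) (i, m) + j • delta = vec (P := P) (i, m + j) := by
  simp [vec, delta]

lemma vec_add_nsmul_delta (i : ι) (m : ℤ) (j : ℕ) :
    vec (P := P) (i, m) + j • delta = vec (P := P) (i, m + j) := by
  rw [← vec_add_zsmul_delta, natCast_zsmul]

lemma add_zsmul_delta_mem : ∀ x ∈ affineRootSet P, ∀ j : ℤ, x + j • delta ∈ affineRootSet P := by
  rintro _ ⟨⟨i, m⟩, rfl⟩ j
  exact ⟨_, (vec_add_zsmul_delta i m j).symm⟩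

lemma add_zsmul_neg_delta_mem :
    ∀ x ∈ affineRootSet P, ∀ j : ℤ, x + j • -delta ∈ affineRootSet P := by
  intro x hx j
  rw [smul_neg, ← neg_smul]
  exact add_zsmul_delta_mem x hx _

lemma isPositiveSystem_posSet (b : P.Base) : IsPositiveSystem (affineRootSet P) (posSet b) where
  subset := by rintro _ ⟨a, -, rfl⟩; exact ⟨a, rfl⟩
  neg_mem := by rintro _ ⟨a, rfl⟩; exact ⟨_, vec_opp a⟩
  total := by
    rintro _ ⟨a, rfl⟩
    rw [← vec_opp, vec_mem_posSet, vec_mem_posSet, isPosAffine_opp]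
    exact em _
  neg_notMem := by
    rintro _ ⟨a, ha, rfl⟩
    rw [← vec_opp, vec_mem_posSet, isPosAffine_opp, not_not]
    exact ha
  add_mem := by
    rintro _ ⟨a, ha, rfl⟩ _ ⟨c, hc, rfl⟩ ⟨e, he⟩
    rw [← he, vec_mem_posSet]
    obtain ⟨h₁, h₂⟩ := vec_eq_add_iff.mp he
    have h₃ := b.height_add h₁
    rw [Set.mem_ofPred_eq, isPosAffine_iff, RootPairing.Base.isPos_iff] at ha hc
    rw [isPosAffine_iff, RootPairing.Base.isPos_iff]
    lia

lemma hasExchange_delta [Finite ι] [P.IsCrystallographic] :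
    HasExchange (affineRootSet P) delta := by
  have key : ∀ a x : AffineRoot P,
      (P.root x.1 - P.root a.1 = 0 ∨ ∃ m, P.root m = P.root x.1 - P.root a.1) →
      (vec x - vec a ∈ affineRootSet P ∨ ∃ j : ℤ, vec x - vec a = j • delta) := by
    rintro ⟨i, m⟩ ⟨k, n⟩ (h | ⟨l, hl⟩)
    · refine .inr ⟨n - m, ?_⟩
      simp only at h
      simp [vec, delta, h]
    · refine .inl ⟨(l, n - m), ?_⟩
      simp only at hl
      simp [vec, hl]
  rintro _ ⟨a, rfl⟩ _ ⟨c, rfl⟩ _ ⟨x, rfl⟩ _ ⟨y, rfl⟩ h ⟨e, he⟩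
  exact (exists_root_sub_of_add_eq_add (congrArg Prod.fst h) (vec_eq_add_iff.mp he).1).imp
    (key a x) (key c x)

variable [P.IsCrystallographic]

/-- The action of `W_a` as additive automorphisms. -/
def affineEquiv (w : AffineWeylGroup P) : (M × ℝ) ≃+ (M × ℝ) where
  toFun := affineLinear w
  invFun := affineLinear w⁻¹
  left_inv x := by
    rw [← affineLinear_mul, inv_mul_cancel]
    exact affineLinear_one x
  right_inv x := by
    rw [← affineLinear_mul, mul_inv_cancel]
    exact affineLinear_one x
  map_add' := map_add _

lemma affineEquiv_vec (w : AffineWeylGroup P) (a : AffineRoot P) :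
    affineEquiv w (vec a) = vec (act w a) := affineLinear_vec w a

lemma affineEquiv_mem (w : AffineWeylGroup P) :
    ∀ x ∈ affineRootSet P, affineEquiv w x ∈ affineRootSet P := by
  rintro _ ⟨a, rfl⟩
  exact ⟨_, (affineEquiv_vec w a).symm⟩

variable [Finite ι] [P.IsReduced] [P.IsRootSystem] [P.IsIrreducible]

-- Three stages: -α for positive α, by adding simple roots one at a time; α + δ, descending in
-- height from θ + δ by adding negative roots; all other levels, by shifting with δ.
variable (b) in
lemma hasSimpleInduction_posSet :
    HasSimpleInduction (posSet b) (vec '' {a : AffineRoot P | IsSimpleAffine b a}) delta := by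
  intro p hS hadd hd
  have hnn : ∀ i : ι, P.reflectionPerm (P.reflectionPerm i i) (P.reflectionPerm i i) = i :=
    fun i ↦ P.root.injective (by rw [root_neg, root_neg, neg_neg])
  have hneg : ∀ i, b.IsPos i → p (vec (P := P) (P.reflectionPerm i i, 0)) := by
    intro i hi
    have hmem : ∀ i, b.IsPos i → vec (P := P) (P.reflectionPerm i i, 0) ∈ posSet b := by
      intro i hi
      rw [vec_mem_posSet, isPosAffine_iff, isPos_neg_iff]
      exact .inr ⟨rfl, not_not.mpr hi⟩
    refine (hi.induction_on_add
      (p := fun i ↦ b.IsPos i ∧ p (vec (P := P) (P.reflectionPerm i i, 0)))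
      (fun i hi ↦ ⟨b.isPos_of_mem_support hi, hS _ ⟨_, .inl ⟨?_, rfl⟩, rfl⟩⟩) ?_).2
    · simpa only [hnn] using hi
    · rintro i j k hk ⟨hi, hpi⟩ hj
      have hjp := b.isPos_of_mem_support hj
      have hkp := hi.add hjp hk
      have he : vec (P := P) (P.reflectionPerm k k, 0) =
          vec (P := P) (P.reflectionPerm i i, 0) + vec (P := P) (P.reflectionPerm j j, 0) := by
        rw [vec_eq_add_iff]
        simp only [root_neg, hk, neg_add, add_zero, and_self]
      refine ⟨hkp, ?_⟩
      have hm := hmem k hkp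
      rw [he] at hm ⊢
      exact hadd _ (hmem i hi) _ (hmem j hjp) hm hpi
        (hS _ ⟨_, .inl ⟨by simpa only [hnn] using hj, rfl⟩, rfl⟩)
  have hone : ∀ i, b.IsPos i → p (vec (P := P) (i, 1)) := by
    have hmem : ∀ i, vec (P := P) (i, 1) ∈ posSet b := fun i ↦ by
      rw [vec_mem_posSet, isPosAffine_iff]
      exact .inl one_pos
    obtain ⟨θ, hθ⟩ := exists_isHighestRoot b
    have hle : ∀ i, b.height i ≤ b.height θ := fun i ↦ by
      rcases eq_or_ne i θ with rfl | h
      · exact le_rfl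
      · exact (hθ i h).height_lt.le
    intro i hi
    induction hn : (b.height θ - b.height i).toNat using Nat.strong_induction_on
      generalizing i with
    | _ n ih =>
      by_cases hmax : IsMaximalRoot b i
      · exact hS _ ⟨(i, 1), .inr ⟨hmax.isHighestRoot, rfl⟩, rfl⟩
      · simp only [IsMaximalRoot, hi, true_and, not_forall, not_not] at hmax
        obtain ⟨j, hj, k, hk⟩ := hmax
        have he : vec (P := P) (i, 1) =
            vec (P := P) (k, 1) + vec (P := P) (P.reflectionPerm j j, 0) := by
          rw [vec_eq_add_iff]
          simp only [root_neg, hk, add_zero, and_true]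
          abel
        have hm := hmem i
        rw [he] at hm ⊢
        refine hadd _ (hmem k) _ ?_ hm (ih _ ?_ k (hi.add hj hk) rfl) (hneg j hj)
        · rw [vec_mem_posSet, isPosAffine_iff, isPos_neg_iff]
          exact .inr ⟨rfl, not_not.mpr hj⟩
        · have h1 := b.height_add hk
          have h2 := hle k
          rw [RootPairing.Base.isPos_iff] at hj
          lia
  have hneg' : ∀ i, ¬ b.IsPos i → p (vec (P := P) (i, 0)) := by
    intro i hi
    have := hneg _ ((isPos_neg_iff b i).mpr hi)
    rwa [hnn] at this
  rintro _ ⟨⟨i, m⟩, h, rfl⟩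
  have h' := h
  rw [Set.mem_ofPred_eq, isPosAffine_iff] at h'
  simp only at h'
  have hstep : ∀ n : ℤ, n < m → IsPosAffine b ((i, n) : AffineRoot P) →
      p (vec (P := P) (i, n)) → p (vec (P := P) (i, m)) := by
    intro n hn hnp ih
    obtain ⟨j, hj⟩ : ∃ j : ℕ, m = n + j := ⟨(m - n).toNat, by lia⟩
    have h₁ := vec_mem_posSet.mpr h
    rw [hj, ← vec_add_nsmul_delta] at h₁ ⊢
    exact hd _ (vec_mem_posSet.mpr hnp) j (by lia) h₁ ih
  by_cases hi : b.IsPos i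
  · rcases (show m = 1 ∨ 1 < m by grind) with rfl | hm
    · exact hone i hi
    · exact hstep 1 hm (isPosAffine_iff.mpr (.inl one_pos)) (hone i hi)
  · rcases (show m = 0 ∨ 0 < m by grind) with rfl | hm
    · exact hneg' i hi
    · exact hstep 0 hm (isPosAffine_iff.mpr (.inr ⟨rfl, hi⟩)) (hneg' i hi)

end AffinePositiveSystem
end ShiIdeal
end

noncomputable section
namespace ShiIdeal

/-! ### Support, and the effect of extremal length on descents and ascents. -/

section Support

variable {ι M N : Type*} [AddCommGroup M] [Module ℝ M] [AddCommGroup N] [Module ℝ N]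
  {P : RootPairing ι ℝ M N} {b : P.Base} {I : Set ι} {w : AffineWeylGroup P}
  [P.IsCrystallographic]

omit [P.IsCrystallographic] in
lemma IsIdeal.mem_of_root_eq_add (hI : IsIdeal b I) {i j k : ι} (hi : i ∈ I) (hj : b.IsPos j)
    (h : P.root k = P.root i + P.root j) : k ∈ I :=
  hI.add_mem i hi j hj k ((hI.pos i hi).add hj h) h

/-- Some α + nδ with n ≥ 1 is an inversion, and lowering the level keeps its image under w⁻¹
negative. -/
lemma not_isPosAffine_act_of_mem (hI : IsIdeal b I) (hw : w ∈ ST b I) {a : AffineRoot P}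
    (ha : a.1 ∈ I) (ha' : a.2 ≤ 1) : ¬ IsPosAffine b (act w⁻¹ a) := by
  obtain ⟨i, m⟩ := a
  have hsupp : i ∈ supp b w := by rw [show supp b w = I from hw]; exact ha
  obtain ⟨n, hn, hn'⟩ := hsupp
  have hip := hI.pos i ha
  rw [isPosAffine_iff] at hn hn' ⊢
  simp only [act] at hn hn' ha' ⊢
  grind

lemma isPosAffine_act_of_notMem (hw : w ∈ ST b I) {a : AffineRoot P}
    (ha : IsPosAffine b a) (ha' : a.1 ∉ I) : IsPosAffine b (act w⁻¹ a) := by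
  by_contra hc
  refine ha' ?_
  rw [← show supp b w = I from hw]
  exact ⟨a.2, ha, hc⟩

lemma mem_of_not_isPosAffine_act (hw : w ∈ ST b I) {a : AffineRoot P}
    (ha : IsPosAffine b a) (hc : ¬ IsPosAffine b (act w⁻¹ a)) : a.1 ∈ I := by
  by_contra ha'
  exact hc (isPosAffine_act_of_notMem hw ha ha')

variable [Finite ι] [P.IsReduced] [P.IsRootSystem] [P.IsIrreducible]

/-- The descents of an element of minimal length in `ST(I)` have level one. -/
lemma IsMinElement.eq_one_of_descent (hI : IsIdeal b I) (hw : IsMinElement b I w)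
    {a β : AffineRoot P} (hβ : IsSimpleAffine b β) (hab : act w⁻¹ a = β.opp)
    (ha : IsPosAffine b a) : a.1 ∈ I ∧ a.2 = 1 := by
  have haw : a = (act w β).opp := by rw [← act_opp, ← hab, act_act_inv]
  have haw' : act w β = a.opp := by rw [haw, opp_opp]
  have hβn : ¬ IsPosAffine b (act w β) := by rwa [haw', isPosAffine_opp, not_not]
  have hβ' : ¬ IsPosAffine b (act w⁻¹ a) := by
    rw [hab, isPosAffine_opp, not_not]
    exact hβ.isPosAffine
  have haI := mem_of_not_isPosAffine_act hw.1 ha hβ'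
  refine ⟨haI, ?_⟩
  by_contra hne
  -- The shorter element w s_β loses only the inversion a. If a has level other than one, the
  -- inversion at level one of the same root survives, so the support is unchanged.
  refine absurd (hw.2 (w * affineReflection β) ?_) (not_le.mpr (length_mul_lt hβ hβn))
  change supp b _ = I
  ext i
  constructor
  · rintro ⟨m, hm, hm'⟩
    by_cases h : ((i, m) : AffineRoot P) = a
    · rw [← h] at haI
      exact haI
    · rw [isPosAffine_act_mul_inv_iff hβ (by rintro h'; exact hβn (h' ▸ hm)) (haw ▸ h)] at hm'
      exact mem_of_not_isPosAffine_act hw.1 hm hm'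
  · intro hi
    have hmem : ∀ m : ℤ, IsPosAffine b ((i, m) : AffineRoot P) →
        ¬ IsPosAffine b (act w⁻¹ ((i, m) : AffineRoot P)) → ((i, m) : AffineRoot P) ≠ a →
        i ∈ supp b (w * affineReflection β) := by
      intro m hm hm' h
      refine ⟨m, hm, ?_⟩
      rwa [isPosAffine_act_mul_inv_iff hβ (by rintro h'; exact hβn (h' ▸ hm)) (haw ▸ h)]
    exact hmem 1 (isPosAffine_iff.mpr (.inl one_pos))
      (not_isPosAffine_act_of_mem hI hw.1 hi le_rfl) (by rintro rfl; exact hne rfl)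

/-- The ascents of an element of maximal length in `ST(I)` lie outside `I`. -/
lemma IsMaxElement.notMem_of_ascent (hw : IsMaxElement b I w)
    {a : AffineRoot P} (hβ : IsSimpleAffine b (act w⁻¹ a)) (ha : IsPosAffine b a) : a.1 ∉ I := by
  intro haI
  have haw : act w (act w⁻¹ a) = a := act_act_inv w a
  -- The longer element gains only the inversion a, whose finite part already lies in I, so the
  -- support is unchanged.
  refine absurd (hw.2 (w * affineReflection (act w⁻¹ a)) ?_)
    (not_le.mpr (lt_length_mul hβ (by rwa [haw])))
  change supp b _ = I
  have hne : ∀ c, IsPosAffine b c → c ≠ (act w (act w⁻¹ a)).opp := by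
    rintro c hc rfl
    rw [haw, isPosAffine_opp] at hc
    exact hc ha
  ext i
  constructor
  · rintro ⟨m, hm, hm'⟩
    by_cases h : ((i, m) : AffineRoot P) = a
    · rw [← h] at haI
      exact haI
    · rw [isPosAffine_act_mul_inv_iff hβ (by rwa [haw]) (hne _ hm)] at hm'
      exact mem_of_not_isPosAffine_act hw.1 hm hm'
  · intro hi
    rw [← show supp b w = I from hw.1] at hi
    obtain ⟨m, hm, hm'⟩ := hi
    refine ⟨m, hm, ?_⟩
    rwa [isPosAffine_act_mul_inv_iff hβ _ (hne _ hm)]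
    rw [haw]
    rintro rfl
    exact hm' hβ.isPosAffine

end Support

/-! ### The element of minimal length. -/

section Minimal

variable {ι M N : Type*} [AddCommGroup M] [Module ℝ M] [AddCommGroup N] [Module ℝ N]
  {P : RootPairing ι ℝ M N} {b : P.Base} {I : Set ι} {w : AffineWeylGroup P}
  [P.IsCrystallographic] [Finite ι] [P.IsReduced] [P.IsRootSystem] [P.IsIrreducible]

variable (b I) in
/-- Generators of the affine roots made negative by the inverse of the minimal element of
`ST(I)`. -/
def minGenerators : Set (M × ℝ) :=
  vec '' {a : AffineRoot P | (a.1 ∈ I ∧ a.2 ≤ 1) ∨ (b.IsPos a.1 ∧ a.2 ≤ 0)}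

omit [P.IsCrystallographic] [Finite ι] [P.IsReduced] [P.IsRootSystem] [P.IsIrreducible] in
lemma vec_mem_minGenerators {a : AffineRoot P} : vec a ∈ minGenerators b I ↔
    (a.1 ∈ I ∧ a.2 ≤ 1) ∨ (b.IsPos a.1 ∧ a.2 ≤ 0) :=
  vec_injective.mem_set_image

omit [P.IsCrystallographic] [Finite ι] [P.IsReduced] [P.IsRootSystem] [P.IsIrreducible] in
lemma isPos_of_sumClosure_minGenerators (hI : IsIdeal b I) {x : M × ℝ}
    (hx : SumClosure (affineRootSet P) (minGenerators b I) x) :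
    ∃ a : AffineRoot P, x = vec a ∧ b.IsPos a.1 := by
  induction hx with
  | base h =>
    obtain ⟨a, ha, rfl⟩ := h
    exact ⟨a, rfl, ha.elim (fun h ↦ hI.pos _ h.1) (fun h ↦ h.1)⟩
  | add _ _ h ih₁ ih₂ =>
    obtain ⟨a, rfl, ha⟩ := ih₁
    obtain ⟨c, rfl, hc⟩ := ih₂
    obtain ⟨e, he⟩ := h
    exact ⟨e, he.symm, ha.add hc (vec_eq_add_iff.mp he).1⟩

-- Two summands in P with positive finite parts have total level at least 2. So for a generator over
-- I one finite part is negative; subtracting it keeps the other summand in I, at level at most 1. A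
-- positive finite root at level at most 0 is never a sum of two elements of P.
omit [P.IsReduced] [P.IsIrreducible] [P.IsCrystallographic] [P.IsRootSystem] [Finite ι] in
lemma minGenerators_coclosed (hI : IsIdeal b I) : ∀ x ∈ posSet b, ∀ y ∈ posSet b,
    x + y ∈ minGenerators b I → x ∈ minGenerators b I ∨ y ∈ minGenerators b I := by
  have key : ∀ a c e : AffineRoot P, IsPosAffine b a → IsPosAffine b c → vec e = vec a + vec c →
      e.1 ∈ I → e.2 ≤ 1 → ¬ b.IsPos a.1 → (c.1 ∈ I ∧ c.2 ≤ 1) := by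
    intro a c e ha hc he heI he1 hap
    obtain ⟨h₁, h₂⟩ := vec_eq_add_iff.mp he
    rw [isPosAffine_iff] at ha
    refine ⟨hI.mem_of_root_eq_add heI ((isPos_neg_iff b a.1).mpr hap) ?_, by lia⟩
    rw [root_neg, h₁]
    abel
  rintro _ ⟨a, ha, rfl⟩ _ ⟨c, hc, rfl⟩ ⟨e, he, hace⟩
  rw [vec_mem_minGenerators, vec_mem_minGenerators]
  obtain ⟨h₁, h₂⟩ := vec_eq_add_iff.mp hace
  have h₃ := b.height_add h₁
  have ha' := isPosAffine_iff.mp ha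
  have hc' := isPosAffine_iff.mp hc
  rcases he with ⟨heI, he1⟩ | ⟨hep, he0⟩
  · by_cases hap : b.IsPos a.1
    · by_cases hcp : b.IsPos c.1
      · grind
      · exact .inl (.inl (key c a e hc ha (by rw [hace, add_comm]) heI he1 hcp))
    · exact .inr (.inl (key a c e ha hc hace heI he1 hap))
  · exfalso
    rw [RootPairing.Base.isPos_iff] at ha' hc' hep
    lia

/-- The minimal roots of `I` give walls of the alcove of the minimal element of `ST(I)`. -/
theorem IsMinElement.exists_act_eq_opp (hI : IsIdeal b I) (hw : IsMinElement b I w) {α : ι}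
    (hα : IsMinimalRoot b I α) :
    ∃ β : AffineRoot P, IsSimpleAffine b β ∧ act w⁻¹ (α, 1) = β.opp := by
  -- The sign makes the roots with negative image under w⁻¹ the preimage of a positive system.
  set f : (M × ℝ) ≃+ (M × ℝ) := (affineEquiv w⁻¹).trans (AddEquiv.neg _)
  have hfv : ∀ a, f (vec a) = vec (act w⁻¹ a).opp := fun a ↦ by
    rw [vec_opp, ← affineEquiv_vec]; rfl
  have hfR : ∀ x ∈ affineRootSet P, f x ∈ affineRootSet P := by
    rintro _ ⟨a, rfl⟩
    exact ⟨_, (hfv a).symm⟩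
  have hfR' : ∀ x ∈ affineRootSet P, f.symm x ∈ affineRootSet P := by
    rintro _ ⟨a, rfl⟩
    refine ⟨(act w a).opp, ?_⟩
    rw [AddEquiv.eq_symm_apply, hfv, act_opp, opp_opp, act_inv_act]
  have hfd : f.symm delta = -delta := by
    rw [AddEquiv.symm_apply_eq, map_neg]
    change delta = - -(affineLinear w⁻¹ delta)
    rw [neg_neg]
    exact (affineLinear_delta w⁻¹).symm
  have hP := isPositiveSystem_posSet b
  have hQ := hP.comap f hfR
  have hmemQ : ∀ a, vec a ∈ {x | x ∈ affineRootSet P ∧ f x ∈ posSet b} ↔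
      ¬ IsPosAffine b (act w⁻¹ a) := by
    intro a
    rw [Set.mem_ofPred_eq, hfv, vec_mem_posSet, isPosAffine_opp]
    exact and_iff_right ⟨a, rfl⟩
  have hQS := (hasSimpleInduction_posSet b).comap hP.subset f hfR'
  rw [hfd] at hQS
  have hαp := hI.pos α hα.1
  have hG : minGenerators b I ⊆ {x | x ∈ affineRootSet P ∧ f x ∈ posSet b} := by
    rintro _ ⟨a, ha, rfl⟩
    rw [hmemQ]
    rcases ha with ⟨ha, ha'⟩ | ⟨ha, ha'⟩
    · exact not_isPosAffine_act_of_mem hI hw.1 ha ha'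
    · intro hc
      have h₁ : IsPosAffine b a.opp := by
        rw [isPosAffine_opp, isPosAffine_iff]
        simp only [ha, not_true_eq_false, and_false, or_false, not_lt, ha']
      have h₂ := mem_of_not_isPosAffine_act hw.1 h₁ (by
        rwa [act_opp, isPosAffine_opp, not_not])
      exact (isPos_neg_iff b a.1).mp (hI.pos _ h₂) ha
  -- The summand v is an inversion, so its finite part is in I; u has positive finite part, so v
  -- would be an element of I below α.
  have hind' : ∀ u v : AffineRoot P,
      SumClosure (affineRootSet P) (minGenerators b I) (vec u) →
      SumClosure (affineRootSet P) (minGenerators b I) (vec v) → IsPosAffine b v →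
      P.root α ≠ P.root u.1 + P.root v.1 := by
    intro u v hu hv hvp h
    have hvI := mem_of_not_isPosAffine_act hw.1 hvp ((hmemQ v).mp (hv.mem_of_subset hQ hG))
    obtain ⟨u', hu', hup⟩ := isPos_of_sumClosure_minGenerators hI hu
    rw [← vec_injective hu'] at hup
    exact hα.2 v.1 (hI.pos _ hvI) (.of_add hup (by rw [h, add_comm])) hvI
  have hsub : ∀ (i : ι) (m : ℤ) (j : ℕ),
      vec (P := P) (i, m) - j • (-delta) = vec (P := P) (i, m + j) := by
    intro i m j
    rw [smul_neg, sub_neg_eq_add, vec_add_nsmul_delta]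
  have hneg : ∀ a : AffineRoot P, IsPosAffine b a → ∀ j : ℕ, 0 < j →
      -(vec a - j • (-delta)) ∉ posSet b := by
    rintro ⟨i, m⟩ ha j hj
    rw [hsub, ← vec_opp, vec_mem_posSet, isPosAffine_opp, not_not]
    rw [isPosAffine_iff] at ha ⊢
    simp only at ha ⊢
    lia
  have hα1 : IsPosAffine b ((α, 1) : AffineRoot P) := isPosAffine_iff.mpr (.inl one_pos)
  have hres : vec (P := P) (α, 1) ∈
      {x | f x ∈ vec '' {a : AffineRoot P | IsSimpleAffine b a}} := by
    refine mem_simple_of_indecomposable hP hQ hQS hasExchange_delta.neg hG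
      add_zsmul_neg_delta_mem ?_ (minGenerators_coclosed hI) ?_ ?_ (vec_mem_posSet.mpr hα1)
      ((hmemQ _).mpr (not_isPosAffine_act_of_mem hI hw.1 hα.1 le_rfl)) ?_ ?_ ?_ ?_
    · rintro _ ⟨⟨i, m⟩, ha, rfl⟩
      have : vec (P := P) (i, m) + -delta = vec (P := P) (i, m - 1) := by
        have := vec_add_zsmul_delta (P := P) i m (-1)
        rwa [neg_one_smul] at this
      rw [this, vec_mem_minGenerators]
      exact ha.imp (And.imp_right fun h ↦ by simp only at h ⊢; lia)
        (And.imp_right fun h ↦ by simp only at h ⊢; lia)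
    · rintro _ ⟨a, ha, rfl⟩ j hj h
      exact absurd h (hneg a ha j hj)
    · rintro x ⟨β, hβ, hx⟩ hxP
      obtain ⟨a, ha, rfl⟩ := hxP
      rw [hfv] at hx
      have hab : act w⁻¹ a = β.opp := by rw [vec_injective hx, opp_opp]
      obtain ⟨h₁, h₂⟩ := hw.eq_one_of_descent hI hβ hab ha
      rw [vec_mem_minGenerators]
      exact .inl ⟨h₁, h₂.le⟩
    -- No such sum is a generator: the level bound forces c to be a negative finite root at level
    -- zero, and the sum would give an element of I below α.
    · rintro _ ⟨c, hc, rfl⟩ ⟨e, he, hce⟩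
      obtain ⟨h₁, h₂⟩ := vec_eq_add_iff.mp hce
      rw [Set.mem_ofPred_eq, isPosAffine_iff] at hc
      simp only at h₁ h₂
      exfalso
      rcases he with ⟨heI, he1⟩ | ⟨-, he0⟩
      · have hcp : ¬ b.IsPos c.1 := by grind
        refine hα.2 e.1 (hI.pos _ heI) (.of_add ((isPos_neg_iff b c.1).mpr hcp) ?_) heI
        rw [h₁, root_neg]
        abel
      · lia
    · intro x y hx hy hyP h
      obtain ⟨u, rfl⟩ := hx.mem_ambient (hG.trans hQ.subset)
      obtain ⟨v, rfl⟩ := hy.mem_ambient (hG.trans hQ.subset)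
      exact hind' u v hx hy (vec_mem_posSet.mp hyP) (vec_eq_add_iff.mp h).1
    -- The level is at least 2, so this is not a generator; in a sum, one summand has positive
    -- level, hence is in P, and `hind'` applies.
    · intro j hj h
      rw [hsub] at h
      generalize hz : vec (P := P) (α, 1 + j) = z at h
      cases h with
      | base h =>
        rw [← hz, vec_mem_minGenerators] at h
        simp only at h
        lia
      | @add x y hx hy h =>
        obtain ⟨u, rfl⟩ := hx.mem_ambient (hG.trans hQ.subset)
        obtain ⟨v, rfl⟩ := hy.mem_ambient (hG.trans hQ.subset)
        obtain ⟨h₁, h₂⟩ := vec_eq_add_iff.mp hz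
        simp only at h₁ h₂
        rcases (show 0 < u.2 ∨ 0 < v.2 by lia) with h₃ | h₃
        · exact hind' v u hy hx (isPosAffine_iff.mpr (.inl h₃)) (by rw [h₁, add_comm])
        · exact hind' u v hx hy (isPosAffine_iff.mpr (.inl h₃)) h₁
    · intro j hj h
      exact absurd h (hneg _ hα1 j hj)
  obtain ⟨β, hβ, h⟩ := hres
  rw [hfv] at h
  exact ⟨β, hβ, by rw [vec_injective h, opp_opp]⟩

end Minimal

/-! ### The element of maximal length. -/

section Maximal

variable {ι M N : Type*} [AddCommGroup M] [Module ℝ M] [AddCommGroup N] [Module ℝ N]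
  {P : RootPairing ι ℝ M N} {b : P.Base} {I : Set ι} {w : AffineWeylGroup P}

variable (b I) in
/-- Generators of the positive affine roots kept positive by the inverse of the maximal element of
`ST(I)`. -/
def maxGenerators : Set (M × ℝ) :=
  vec '' {a : AffineRoot P | IsPosAffine b a ∧ a.1 ∉ I}

lemma vec_mem_maxGenerators {a : AffineRoot P} : vec a ∈ maxGenerators b I ↔
    IsPosAffine b a ∧ a.1 ∉ I :=
  vec_injective.mem_set_image

/-- If both finite parts were in I, so would be their sum. -/
lemma maxGenerators_coclosed (hI : IsIdeal b I) : ∀ x ∈ posSet b, ∀ y ∈ posSet b,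
    x + y ∈ maxGenerators b I → x ∈ maxGenerators b I ∨ y ∈ maxGenerators b I := by
  rintro _ ⟨a, ha, rfl⟩ _ ⟨c, hc, rfl⟩ ⟨e, he, hace⟩
  rw [vec_mem_maxGenerators, vec_mem_maxGenerators]
  by_contra! h
  have haI := h.1 ha
  have hcI := h.2 hc
  have h₁ := (vec_eq_add_iff.mp hace).1
  exact he.2 (hI.add_mem _ haI _ (hI.pos _ hcI) _ ((hI.pos _ haI).add (hI.pos _ hcI) h₁) h₁)

variable [P.IsCrystallographic] [Finite ι] [P.IsReduced] [P.IsRootSystem] [P.IsIrreducible]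

/-- The maximal roots outside `I` give walls of the alcove of the maximal element of `ST(I)`. -/
theorem IsMaxElement.isSimpleAffine_act (hI : IsIdeal b I) (hw : IsMaxElement b I w) {α : ι}
    (hα : IsMaximalOutside b I α) : IsSimpleAffine b (act w⁻¹ ((α, 1) : AffineRoot P)) := by
  set f : (M × ℝ) ≃+ (M × ℝ) := affineEquiv w⁻¹
  have hfv : ∀ a, f (vec a) = vec (act w⁻¹ a) := affineEquiv_vec w⁻¹
  have hfR : ∀ x ∈ affineRootSet P, f x ∈ affineRootSet P := affineEquiv_mem w⁻¹
  have hfR' : ∀ x ∈ affineRootSet P, f.symm x ∈ affineRootSet P := affineEquiv_mem w⁻¹⁻¹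
  have hfd : f.symm delta = delta := affineLinear_delta w⁻¹⁻¹
  have hP := isPositiveSystem_posSet b
  have hQ := hP.comap f hfR
  have hmemQ : ∀ a, vec a ∈ {x | x ∈ affineRootSet P ∧ f x ∈ posSet b} ↔
      IsPosAffine b (act w⁻¹ a) := by
    intro a
    rw [Set.mem_ofPred_eq, hfv, vec_mem_posSet]
    exact and_iff_right ⟨a, rfl⟩
  have hQS := (hasSimpleInduction_posSet b).comap hP.subset f hfR'
  rw [hfd] at hQS
  obtain ⟨⟨hαp, hαI⟩, hαmax⟩ := hα
  have hG : maxGenerators b I ⊆ {x | x ∈ affineRootSet P ∧ f x ∈ posSet b} := by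
    rintro _ ⟨a, ha, rfl⟩
    rw [hmemQ]
    exact isPosAffine_act_of_notMem hw.1 ha.1 ha.2
  have hGP : maxGenerators b I ⊆ posSet b := by
    rintro _ ⟨a, ha, rfl⟩
    exact vec_mem_posSet.mpr ha.1
  have hnotI : ∀ i, ¬ b.IsPos i → i ∉ I := fun i hi h ↦ hi (hI.pos i h)
  have hsub : ∀ (i : ι) (m : ℤ) (j : ℕ),
      vec (P := P) (i, m) - j • delta = vec (P := P) (i, m - j) := by
    intro i m j
    rw [sub_eq_iff_eq_add, vec_add_nsmul_delta, sub_add_cancel]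
  have hopp : ∀ a : AffineRoot P, b.IsPos a.1 → ∀ j : ℕ, -(vec a - j • delta) ∈ posSet b →
      -(vec a - j • delta) ∈ maxGenerators b I := by
    rintro ⟨i, m⟩ hi j h
    rw [hsub, ← vec_opp] at h ⊢
    exact vec_mem_maxGenerators.mpr
      ⟨vec_mem_posSet.mp h, hnotI _ (by rw [AffineRoot.opp, isPos_neg_iff, not_not]; exact hi)⟩
  have hα1 : IsPosAffine b ((α, 1) : AffineRoot P) := isPosAffine_iff.mpr (.inl one_pos)
  -- Levels add up to 1, so v has level 1 and u is a negative finite root at level 0. Then v lies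
  -- above α, and it is outside I because w⁻¹ keeps it positive at level 1.
  have hind' : ∀ u v : AffineRoot P, IsPosAffine b u → IsPosAffine b v →
      IsPosAffine b (act w⁻¹ v) → b.IsPos v.1 → vec (P := P) (α, 1) ≠ vec u + vec v := by
    intro u v hu hv hvw hvp h
    obtain ⟨h₁, h₂⟩ := vec_eq_add_iff.mp h
    rw [isPosAffine_iff] at hu hv
    simp only at h₁ h₂
    have hup : ¬ b.IsPos u.1 := by grind
    have hvI : v.1 ∉ I := fun hvI ↦
      not_isPosAffine_act_of_mem hI hw.1 hvI (by lia) hvw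
    refine hαmax v.1 hvp hvI (.of_add ((isPos_neg_iff b u.1).mpr hup) ?_)
    rw [h₁, root_neg]
    abel
  have hres : vec (P := P) (α, 1) ∈
      {x | f x ∈ vec '' {a : AffineRoot P | IsSimpleAffine b a}} := by
    refine mem_simple_of_indecomposable hP hQ hQS hasExchange_delta hG
      add_zsmul_delta_mem ?_ (maxGenerators_coclosed hI) ?_ ?_ (vec_mem_posSet.mpr hα1)
      ((hmemQ _).mpr (isPosAffine_act_of_notMem hw.1 hα1 hαI)) ?_ ?_ ?_ ?_
    · rintro _ ⟨⟨i, m⟩, ha, rfl⟩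
      have : vec (P := P) (i, m) + delta = vec (P := P) (i, m + 1) := by
        simpa using vec_add_nsmul_delta (P := P) i m 1
      rw [this, vec_mem_maxGenerators]
      refine ⟨?_, ha.2⟩
      have := ha.1
      rw [isPosAffine_iff] at this ⊢
      simp only at this ⊢
      lia
    · rintro _ ⟨a, ha, rfl⟩ j hj h
      by_cases hap : b.IsPos a.1
      · exact .inr (hopp a hap j h)
      · exact .inl (vec_mem_maxGenerators.mpr ⟨ha, hnotI _ hap⟩)
    · rintro x ⟨β, hβ, hx⟩ hxP
      obtain ⟨a, ha, rfl⟩ := hxP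
      rw [hfv] at hx
      rw [vec_injective hx] at hβ
      exact vec_mem_maxGenerators.mpr ⟨ha, hw.notMem_of_ascent hβ ha⟩
    -- If the finite part of c were in I, adding it to α would give a root above α and outside I.
    · rintro _ ⟨c, hc, rfl⟩ ⟨e, he, hce⟩
      rw [vec_mem_maxGenerators]
      refine ⟨hc, fun hcI ↦ ?_⟩
      have h₁ := (vec_eq_add_iff.mp hce).1
      have hcp := hI.pos _ hcI
      exact hαmax e.1 (hαp.add hcp h₁) he.2 (.of_add hcp h₁)
    · intro x y hx hy hyP h
      obtain ⟨u, rfl⟩ := hx.mem_ambient (hG.trans hQ.subset)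
      obtain ⟨v, rfl⟩ := hy.mem_ambient (hG.trans hQ.subset)
      have hu := vec_mem_posSet.mp (hx.mem_of_subset hP hGP)
      have hv := vec_mem_posSet.mp hyP
      have huw := (hmemQ u).mp (hx.mem_of_subset hQ hG)
      have hvw := (hmemQ v).mp (hy.mem_of_subset hQ hG)
      by_cases hvp : b.IsPos v.1
      · exact hind' u v hu hv hvw hvp h
      · by_cases hup : b.IsPos u.1
        · exact hind' v u hv hu huw hup (by rw [h, add_comm])
        · have h₃ := b.height_add (vec_eq_add_iff.mp h).1
          rw [RootPairing.Base.isPos_iff] at hup hvp hαp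
          simp only at h₃
          lia
    -- Lowering α + δ by at least one δ leaves P, while the closure stays inside P.
    · intro j hj h
      rw [hsub] at h
      have := vec_mem_posSet.mp (h.mem_of_subset hP hGP)
      rw [isPosAffine_iff] at this
      simp only [hαp, not_true_eq_false, and_false, or_false] at this
      lia
    · intro j hj h
      exact hopp _ hαp j h
  obtain ⟨β, hβ, h⟩ := hres
  rw [hfv] at h
  rwa [← vec_injective h]

end Maximal
end ShiIdeal
end
theorem mainTheorem8 {ι M N : Type*} [Finite ι] [AddCommGroup M] [Module ℝ M]
    [AddCommGroup N] [Module ℝ N]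
    (P : RootPairing ι ℝ M N) [P.IsRootSystem] [P.IsCrystallographic] [P.IsReduced]
    [P.IsIrreducible] (b : P.Base) (I : Set ι) (hI : ShiIdeal.IsIdeal b I) :
    (∀ w : ShiIdeal.AffineWeylGroup P, ShiIdeal.IsMinElement b I w →
      ∀ α : ι, ShiIdeal.IsMinimalRoot b I α →
        ∃ β : ShiIdeal.AffineRoot P, ShiIdeal.IsSimpleAffine b β ∧
          ShiIdeal.act w⁻¹ (α, 1) = β.opp) ∧
    (ShiIdeal.IsStrictlyPositive b I →
      ∀ w : ShiIdeal.AffineWeylGroup P, ShiIdeal.IsMaxElement b I w →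
        ∀ α : ι, ShiIdeal.IsMaximalOutside b I α →
          ShiIdeal.IsSimpleAffine b (ShiIdeal.act w⁻¹ (α, 1))) :=
  ⟨fun _ hw _ hα ↦ hw.exists_act_eq_opp hI hα, fun _ _ hw _ hα ↦ hw.isSimpleAffine_act hI hα⟩
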